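/- Let $n>m>1$ be integers. Let $\mathbb{X}_{m,n}$ be the space of configurations $[p_1,\ldots,p_n]$ of $n$ points in general position in $\mathbb{P}^{m-1}(\mathbb{C})$, modulo $PGL_m(\mathbb{C})$. Normalizing $p_1,\ldots,p_m$ to the coordinate points, $p_{m+1}=(1:\cdots:1)$ and $p_j=(u_{1,j}:\cdots:u_{m-1,j}:1)$ for $m+2\le j\le n$, its field of rational functions is $\mathcal{K}(\mathbb{X}_{m,n})=\mathbb{C}(u_{i,j}\mid 1\le i\le m-1,\ m+2\le j\le n)$. We put $p_{n+1}=q=(z_1:\cdots:z_{m-1}:1)$, so that $\mathcal{K}(\mathbb{X}_{m,n+1})=\mathcal{K}(\mathbb{X}_{m,n})(z_1,\ldots,z_{m-1})$, with $z_i=u_{i,n+1}$. Let $W_{m,n}=\langle s_0,\ldots,s_{n-1}\rangle$ be the Weyl group of the tree $T_{2,m,n-m}$ (the chain with nodes $1,\ldots,n-1$, and the node $0$ joined to the node $m$). It acts from the left by automorphisms over $\mathbb{C}$ on $\mathcal{K}(\mathbb{X}_{m,n})$ and, through $W_{m,n}\to W_{m,n+1}$, $s_k\mapsto s_k$, on $\mathcal{K}(\mathbb{X}_{m,n+1})$,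 by $w(\varphi)([p_1,p_2,\ldots])=\varphi([p_1,p_2,\ldots].w)$, where $s_k$ ($k\ge1$) exchanges the $k$-th and $(k+1)$-st points and $s_0$ is the standard Cremona transformation with respect to $p_1,\ldots,p_m$. Explicitly: $$s_0(u_{ij})=\frac1{u_{ij}};\qquad s_k(u_{ij})=u_{s_k(i),j}\ (1\le k\le m-2);$$ $$s_{m-1}(u_{ij})=\frac{u_{ij}}{u_{m-1,j}}\ (i\le m-2),\qquad s_{m-1}(u_{m-1,j})=\frac1{u_{m-1,j}};\qquad s_m(u_{ij})=1-u_{ij};$$ $$s_{m+1}(u_{i,m+2})=\frac1{u_{i,m+2}},\qquad s_{m+1}(u_{ij})=\frac{u_{ij}}{u_{i,m+2}}\ (j\ge m+3);\qquad s_k(u_{ij})=u_{i,s_k(j)}\ (k\ge m+2),$$ where $s_k$ acts on indices as the transposition $(k,k+1)$. The group $W_{m,n}$ also acts linearly on the lattice $L_{m,n}=\mathbb{Z}e_0\oplus\mathbb{Z}e_1\oplus\cdots\oplus\mathbb{Z}e_n$ by $s_k.\Lambda=\Lambda-\langle h_k,\Lambda\rangle h_k$, where the $e_j$ are orthogonal,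 $\langle e_0,e_0\rangle=-(m-2)$, $\langle e_j,e_j\rangle=1$ for $1\le j\le n$, $h_0=e_0-e_1-\cdots-e_m$, and $h_k=e_k-e_{k+1}$ for $1\le k\le n-1$. Fix nonzero $a_1,\ldots,a_m\in\mathcal{K}(\mathbb{X}_{m,n})$, and let $x=(x_1,\ldots,x_m)$ be the homogeneous coordinates of $\mathbb{P}^{m-1}$ over $\mathcal{K}(\mathbb{X}_{m,n})$ with $(z_1:\cdots:z_{m-1}:1)=(a_1x_1:\cdots:a_mx_m)$. For $\Lambda=de_0-\nu_1e_1-\cdots-\nu_ne_n\in L_{m,n}$, let $L(\Lambda)$ be the $\mathcal{K}(\mathbb{X}_{m,n})$-vector space of all homogeneous polynomials $f\in\mathcal{K}(\mathbb{X}_{m,n})[x_1,\ldots,x_m]$ of degree $d$ (together with $0$) that have a zero of multiplicity $\ge\nu_j$ at $p_j$ for $j=1,\ldots,n$ (no condition if $\nu_j\le0$). Then: (1) For every $\Lambda$ in the orbit $M_{m,n}=W_{m,n}\{e_1,\ldots,e_n\}$, one has $\dim_{\mathcal{K}(\mathbb{X}_{m,n})}L(\Lambda)=1$. (2) Let $w\in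 W_{m,n}$, and take any nonzero polynomials $F_i\in L(w.e_i)$ and $G_i\in L(ws_0.e_i)$ for $i=1,\ldots,m$. Then there are nonzero constants $c_1,\ldots,c_m\in\mathcal{K}(\mathbb{X}_{m,n})$ such that $$(w(z_1):\cdots:w(z_{m-1}):1)=\left(c_1\frac{G_1(x)}{F_1(x)}:\cdots:c_m\frac{G_m(x)}{F_m(x)}\right).$$ -/

import Mathlib

namespace PointConfig

/-- The adjacent transposition `(k, k+1)` of the natural numbers. -/
def adj (k i : ℕ) : ℕ := if i = k then k + 1 else if i = k + 1 then k else i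

/-! ### The Weyl group of the tree `T_{2,m,n-m}` -/

/-- The nodes `k` and `l` of the tree are joined by an edge: `α₁ — α₂ — ⋯ — α_{n-1}` is a chain,
and `α₀` is attached to `α_m`. -/
def Joined (m k l : ℕ) : Prop :=
  (1 ≤ k ∧ 1 ≤ l ∧ (l = k + 1 ∨ k = l + 1)) ∨ (k = 0 ∧ l = m) ∨ (l = 0 ∧ k = m)

instance (m k l : ℕ) : Decidable (Joined m k l) := by unfold Joined; infer_instance

/-- The Coxeter matrix of the tree `T_{2,m,n-m}` with nodes `0, 1, …, n-1`. -/
def coxeterMatrix (m n : ℕ) : CoxeterMatrix (Fin n) where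
  M := Matrix.of fun k l => if k = l then 1 else if Joined m k l then 3 else 2
  isSymm := by
    ext k l
    have h : Joined m k l ↔ Joined m l k := by unfold Joined; omega
    simp only [Matrix.transpose_apply, Matrix.of_apply, h, eq_comm]
  diagonal k := by simp
  off_diagonal k l h := by
    simp only [Matrix.of_apply, if_neg h]
    split_ifs <;> omega

/-- The Weyl group `W_{m,n}`, given by its Coxeter presentation. -/
abbrev W (m n : ℕ) : Type := (coxeterMatrix m n).Group

/-- The simple reflection `s_k` of `W_{m,n}`. -/
def s (m n : ℕ) (k : Fin n) : W m n := (coxeterMatrix m n).simple k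

/-- A family of elements of a monoid satisfying `x_k² = 1`, the commutation relations and the braid
relations extends to the Coxeter group. -/
theorem isLiftable_of_relations {G : Type*} [Monoid G] (m n : ℕ) (f : Fin n → G)
    (h1 : ∀ k, f k * f k = 1)
    (h2 : ∀ k l : Fin n, k ≠ l → ¬ Joined m k l → f k * f l = f l * f k)
    (h3 : ∀ k l : Fin n, Joined m k l → f k * f l * f k = f l * f k * f l) :
    (coxeterMatrix m n).IsLiftable f := by
  intro k l
  show (f k * f l) ^ (if k = l then 1 else if Joined m k l then 3 else 2) = 1
  split_ifs with h h'
  · subst h; simp [h1]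
  · have e : (f k * f l) ^ 3 = (f k * f l * f k) * (f l * f k * f l) := by
      simp only [pow_succ, pow_zero, one_mul, mul_assoc]
    rw [e, ← h3 k l h']
    calc f k * f l * f k * (f k * f l * f k) = f k * f l * (f k * f k) * f l * f k := by
          simp only [mul_assoc]
      _ = f k * (f l * f l) * f k := by rw [h1]; simp only [mul_one, mul_assoc]
      _ = 1 := by rw [h1, mul_one, h1]
  · rw [pow_two]
    calc f k * f l * (f k * f l) = f k * f l * (f l * f k) := by rw [h2 k l h h']
      _ = f k * (f l * f l) * f k := by simp only [mul_assoc]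
      _ = 1 := by rw [h1, mul_one, h1]

/-- The inclusion `W_{m,n} ⊂ W_{m,n+1}`, `s_k ↦ s_k`. -/
noncomputable def inclW (m n : ℕ) : W m n →* W m (n + 1) :=
  (coxeterMatrix m n).toCoxeterSystem.lift
    ⟨fun k => s m (n + 1) k.castSucc, by
      intro k l
      have h := (coxeterMatrix m (n + 1)).toCoxeterSystem.simple_mul_simple_pow
        k.castSucc l.castSucc
      have e : (coxeterMatrix m (n + 1)) k.castSucc l.castSucc = (coxeterMatrix m n) k l := by
        show (if k.castSucc = l.castSucc then 1 else
          if Joined m k.castSucc l.castSucc then 3 else 2) =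
          (if k = l then 1 else if Joined m k l then 3 else 2)
        simp
      rw [e] at h
      exact h⟩

/-! ### The lattice `L_{m,n}` and its Weyl group action -/

/-- The lattice `L_{m,n} = ℤe₀ ⊕ ℤe₁ ⊕ ⋯ ⊕ ℤe_n`, in coordinates. -/
abbrev Lat (n : ℕ) : Type := Fin (n + 1) → ℤ

/-- The basis vector `e_j` (`0 ≤ j ≤ n`). -/
def e (n j : ℕ) : Lat n := fun i => if (i : ℕ) = j then 1 else 0

/-- The symmetric bilinear form on `L_{m,n}`: the `e_j` are orthogonal, `⟨e₀, e₀⟩ = -(m - 2)` and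
`⟨e_j, e_j⟩ = 1` for `j ≥ 1`. -/
def pairing (m n : ℕ) (v v' : Lat n) : ℤ :=
  -((m : ℤ) - 2) * v 0 * v' 0 + ∑ j : Fin n, v j.succ * v' j.succ

/-- `h₀ = e₀ - e₁ - ⋯ - e_m` and `h_k = e_k - e_{k+1}` for `k ≥ 1`. -/
def h (m n k : ℕ) : Lat n :=
  if k = 0 then e n 0 - ∑ j ∈ Finset.Icc 1 m, e n j else e n k - e n (k + 1)

theorem pairing_add (m n : ℕ) (v x y : Lat n) :
    pairing m n v (x + y) = pairing m n v x + pairing m n v y := by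
  simp only [pairing, Pi.add_apply, mul_add, Finset.sum_add_distrib]; ring

theorem pairing_smul (m n : ℕ) (v x : Lat n) (c : ℤ) :
    pairing m n v (c • x) = c * pairing m n v x := by
  simp only [pairing, Pi.smul_apply, smul_eq_mul, mul_add, Finset.mul_sum]
  congr 1
  · ring
  · exact Finset.sum_congr rfl fun _ _ => by ring

theorem pairing_comm (m n : ℕ) (v x : Lat n) : pairing m n v x = pairing m n x v := by
  simp only [pairing]
  congr 1
  · ring
  · exact Finset.sum_congr rfl fun _ _ => by ring

/-- The reflection `Λ ↦ Λ - ⟨h_k, Λ⟩ h_k` of `L_{m,n}`. -/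
def latRefl (m n k : ℕ) : Module.End ℤ (Lat n) where
  toFun v := v - pairing m n (h m n k) v • h m n k
  map_add' x y := by rw [pairing_add, add_smul]; abel
  map_smul' c x := by rw [pairing_smul, mul_smul, RingHom.id_apply, smul_sub]

theorem e_apply_zero (n j : ℕ) : e n j 0 = if j = 0 then 1 else 0 := by
  unfold e
  simp only [Fin.val_zero, eq_comm]

theorem h_apply_zero (m n k : ℕ) : h m n k 0 = if k = 0 then 1 else 0 := by
  unfold h
  split_ifs with hk
  · simp only [Pi.sub_apply, Finset.sum_apply, e_apply_zero, if_true]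
    rw [Finset.sum_eq_zero, sub_zero]
    intro i hi
    rw [Finset.mem_Icc] at hi
    exact if_neg (by omega)
  · simp only [Pi.sub_apply, e_apply_zero, if_neg hk]
    simp

theorem h_apply_succ (m n k : ℕ) (j : Fin n) : h m n k j.succ =
    if k = 0 then (if (j : ℕ) + 1 ≤ m then -1 else 0)
    else (if (j : ℕ) + 1 = k then 1 else 0) - (if (j : ℕ) + 1 = k + 1 then 1 else 0) := by
  unfold h
  split_ifs with hk <;> simp [e, Finset.sum_apply, *] <;> omega

theorem h_apply_mk (m n k j : ℕ) (hj : j + 1 < n + 1) : h m n k ⟨j + 1, hj⟩ =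
    if k = 0 then (if j + 1 ≤ m then -1 else 0)
    else (if j + 1 = k then 1 else 0) - (if j + 1 = k + 1 then 1 else 0) :=
  h_apply_succ m n k ⟨j, by omega⟩

theorem pairing_h (m n : ℕ) (k : ℕ) (hk : k < n) (v : Lat n) : pairing m n (h m n k) v =
    if k = 0 then -((m : ℤ) - 2) * v 0 - ∑ j ∈ Finset.univ.filter (fun j : Fin n => (j : ℕ) + 1 ≤ m),
      v j.succ
    else v ⟨k, by omega⟩ - v ⟨k + 1, by omega⟩ := by
  unfold pairing
  simp only [h_apply_zero, h_apply_succ]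
  split_ifs with h0
  · simp only [mul_one, ite_mul, neg_mul, one_mul, zero_mul, sub_eq_add_neg, ← Finset.sum_neg_distrib]
    rw [Finset.sum_filter]
  · obtain ⟨k, rfl⟩ := Nat.exists_eq_succ_of_ne_zero h0
    have e1 : ∀ j : Fin n, ((j : ℕ) + 1 = k.succ) ↔ j = ⟨k, by omega⟩ := fun j => by
      rw [Fin.ext_iff]; simp
    have e2 : ∀ j : Fin n, ((j : ℕ) + 1 = k.succ + 1) ↔ j = ⟨k + 1, by omega⟩ := fun j => by
      rw [Fin.ext_iff]; simp
    simp only [e1, e2, sub_mul, Finset.sum_sub_distrib, ite_mul, one_mul, zero_mul,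
      Finset.sum_ite_eq', Finset.mem_univ, if_true, mul_zero, zero_add]
    rfl

/-- The Gram matrix of the `h_k` is the Cartan matrix of the tree. -/
theorem pairing_h_h (m n : ℕ) (hn : m < n) (k l : ℕ) (hk : k < n) (hl : l < n) :
    pairing m n (h m n k) (h m n l) = if k = l then 2 else if Joined m k l then -1 else 0 := by
  wlog hkl : k ≠ 0 ∨ l = 0 generalizing k l
  · rw [pairing_comm, this l k hl hk (by omega)]
    have h : Joined m k l ↔ Joined m l k := by unfold Joined; omega
    simp only [h, eq_comm]
  rw [pairing_h m n k hk]
  rcases Nat.eq_zero_or_pos k with rfl | hk0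
  · obtain rfl : l = 0 := by omega
    simp only [h_apply_zero, h_apply_succ, if_true]
    rw [Finset.sum_congr rfl (g := fun _ => (-1 : ℤ))
      (fun j hj => by rw [if_pos (Finset.mem_filter.1 hj).2])]
    have : (Finset.univ.filter (fun j : Fin n => (j : ℕ) + 1 ≤ m)).card = m := by
      have := Fin.card_filter_val_lt (n := n) (m := m)
      simpa only [Nat.lt_iff_add_one_le, min_eq_right hn.le] using this
    rw [Finset.sum_const, this]
    simp
  · obtain ⟨k, rfl⟩ := Nat.exists_eq_succ_of_ne_zero (by omega : k ≠ 0)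
    rw [if_neg (by omega), h_apply_mk m n l k, h_apply_mk m n l (k + 1)]
    have hJ : Joined m k.succ l ↔ (1 ≤ l ∧ (l = k + 2 ∨ k = l)) ∨ (l = 0 ∧ k + 1 = m) := by
      unfold Joined; omega
    simp only [hJ]
    split_ifs <;> omega

/-- The linear action of `W_{m,n}` on `L_{m,n}` with `s_k.Λ = Λ - ⟨h_k, Λ⟩ h_k`. -/
noncomputable def latAct (m n : ℕ) (hn : m < n) : W m n →* Module.End ℤ (Lat n) :=
  (coxeterMatrix m n).toCoxeterSystem.lift
    ⟨fun k => latRefl m n k, by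
      have key : ∀ (k : Fin n) (v : Lat n), latRefl m n k v =
          v - pairing m n (h m n k) v • h m n k := fun _ _ => rfl
      have sub : ∀ (v x y : Lat n), pairing m n v (x - y) = pairing m n v x - pairing m n v y := by
        intro v x y
        have := pairing_add m n v (x - y) y
        rw [sub_add_cancel] at this; omega
      have P := fun k l : Fin n => pairing_h_h m n hn (k : ℕ) (l : ℕ) k.2 l.2
      refine isLiftable_of_relations m n _ ?_ ?_ ?_
      · intro k
        refine LinearMap.ext fun v => ?_
        have a1 := P k k
        rw [if_pos rfl] at a1
        simp only [Module.End.mul_apply, key, sub, pairing_smul, a1, Module.End.one_apply]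
        generalize pairing m n _ _ = A
        generalize h m n k = x
        module
      · intro k l hkl hJ
        refine LinearMap.ext fun v => ?_
        have a1 := P k l
        have a2 := P l k
        have h' : ¬ Joined m l k := by unfold Joined at *; omega
        rw [if_neg (fun hh => hkl (Fin.ext hh)), if_neg hJ] at a1
        rw [if_neg (fun hh => hkl (Fin.ext hh.symm)), if_neg h'] at a2
        simp only [Module.End.mul_apply, key, sub, pairing_smul, a1, a2]
        generalize pairing m n (h m n k) v = A
        generalize pairing m n (h m n l) v = B
        generalize h m n k = x
        generalize h m n l = y
        module
      · intro k l hJ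
        refine LinearMap.ext fun v => ?_
        have h' : Joined m l k := by unfold Joined at *; omega
        by_cases hkl : k = l
        · subst hkl; rfl
        have a1 := P k l
        have a2 := P l k
        have b1 := P k k
        have b2 := P l l
        rw [if_neg (fun hh => hkl (Fin.ext hh)), if_pos hJ] at a1
        rw [if_neg (fun hh => hkl (Fin.ext hh.symm)), if_pos h'] at a2
        rw [if_pos rfl] at b1 b2
        simp only [Module.End.mul_apply, key, sub, pairing_smul, a1, a2, b1, b2]
        generalize pairing m n (h m n k) v = A
        generalize pairing m n (h m n l) v = B
        generalize h m n k = x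
        generalize h m n l = y
        module⟩


/-! ### The function field of the configuration space and its Weyl group action -/

/-- The index set of the coordinates `u_{i,j}` (`1 ≤ i ≤ m-1`, `m+2 ≤ j ≤ n`) of `𝕏_{m,n}`. -/
abbrev Idx (m n : ℕ) : Type :=
  {p : ℕ × ℕ // 1 ≤ p.1 ∧ p.1 + 1 ≤ m ∧ m + 2 ≤ p.2 ∧ p.2 ≤ n}

instance (m n : ℕ) : Finite (Idx m n) :=
  Set.Finite.to_subtype (((Set.finite_Iic m).prod (Set.finite_Iic n)).subset
    fun p hp => ⟨Set.mem_Iic.2 (by have := hp.2.1; omega), hp.2.2.2⟩)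

/-- The field `𝒦(𝕏_{m,n}) = ℂ(u)` of rational functions in the coordinates `u_{i,j}`. -/
abbrev KX (m n : ℕ) : Type := FractionRing (MvPolynomial (Idx m n) ℂ)

/-- The coordinate function `u_{i,j}` (`1 ≤ i ≤ m-1`, `m+2 ≤ j ≤ n`), extended by
`u_{m,j} = u_{i,m+1} = 1`, the last row and the `(m+1)`-st column of the normalized matrix. -/
noncomputable def u (m n i j : ℕ) : KX m n :=
  if hij : 1 ≤ i ∧ i + 1 ≤ m ∧ m + 2 ≤ j ∧ j ≤ n then
    algebraMap (MvPolynomial (Idx m n) ℂ) (KX m n) (MvPolynomial.X ⟨(i, j), hij⟩)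
  else 1

/-- The table of the action of the simple reflection `s_k` on the coordinates:
`table m k v i j` is `s_k(u_{i,j})`, as an expression in the coordinates `v = (u_{i,j})`. -/
def table {E : Type*} [Field E] (m k : ℕ) (v : ℕ → ℕ → E) (i j : ℕ) : E :=
  if k = 0 then 1 / v i j
  else if k + 2 ≤ m then v (adj k i) j
  else if k + 1 = m then (if i + 1 = m then 1 / v (m - 1) j else v i j / v (m - 1) j)
  else if k = m then 1 - v i j
  else if k = m + 1 then (if j = m + 2 then 1 / v i (m + 2) else v i j / v i (m + 2))
  else v i (adj k j)

/-- A form of the table that is uniform in the extended coordinates. -/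
def table' {E : Type*} [Field E] (m k : ℕ) (v : ℕ → ℕ → E) (i j : ℕ) : E :=
  if k = 0 then (v i j)⁻¹
  else if k < m then v (adj k i) j / v (adj k m) j
  else if k = m then (if i = m ∨ j = m + 1 then 1 else 1 - v i j)
  else v i (adj k j) / v i (adj k (m + 1))

theorem u_eq_one {m n i j : ℕ} (h : i = m ∨ j = m + 1) : u m n i j = 1 := by
  unfold u; rw [dif_neg]; omega

theorem u_ne_zero (m n i j : ℕ) : u m n i j ≠ 0 := by
  unfold u
  split_ifs with h
  · exact (map_ne_zero_iff _ (IsFractionRing.injective _ _)).2 (MvPolynomial.X_ne_zero _)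
  · exact one_ne_zero

theorem one_sub_u_ne_zero {m n i j : ℕ} (h : 1 ≤ i ∧ i + 1 ≤ m ∧ m + 2 ≤ j ∧ j ≤ n) :
    1 - u m n i j ≠ 0 := by
  unfold u
  rw [dif_pos h, ← map_one (algebraMap (MvPolynomial (Idx m n) ℂ) (KX m n)), ← map_sub]
  refine (map_ne_zero_iff _ (IsFractionRing.injective _ _)).2 fun h0 => ?_
  have := congrArg (MvPolynomial.eval fun _ => (0 : ℂ)) h0
  simp at this

theorem table_eq {m n k i j : ℕ} (hk : k < n) (h : 1 ≤ i ∧ i + 1 ≤ m ∧ m + 2 ≤ j ∧ j ≤ n) :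
    table m k (u m n) i j = table' m k (u m n) i j := by
  unfold table table'
  by_cases h0 : k = 0
  · simp [h0]
  rw [if_neg h0, if_neg h0]
  by_cases h1 : k + 2 ≤ m
  · have : adj k m = m := by unfold adj; split_ifs <;> omega
    rw [if_pos h1, if_pos (by omega), this, u_eq_one (i := m) (Or.inl rfl), div_one]
  rw [if_neg h1]
  by_cases h2 : k + 1 = m
  · have e1 : adj k m = k := by unfold adj; split_ifs <;> omega
    have e3 : m - 1 = k := by omega
    rw [if_pos h2, if_pos (show k < m by omega), e1, e3]
    by_cases h3 : i = k
    · have e2 : adj k i = m := by unfold adj; split_ifs <;> omega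
      rw [if_pos (by omega), e2, u_eq_one (i := m) (Or.inl rfl)]
    · have e2 : adj k i = i := by unfold adj; split_ifs <;> omega
      rw [if_neg (by omega), e2]
  rw [if_neg h2, if_neg (show ¬ k < m by omega)]
  by_cases h3 : k = m
  · subst h3
    rw [if_pos rfl, if_pos rfl, if_neg (by omega)]
  rw [if_neg h3, if_neg h3]
  by_cases h4 : k = m + 1
  · subst h4
    have e1 : adj (m + 1) (m + 1) = m + 2 := by simp [adj]
    rw [if_pos rfl, e1]
    by_cases h5 : j = m + 2
    · subst h5
      have e2 : adj (m + 1) (m + 2) = m + 1 := by simp [adj]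
      rw [if_pos rfl, e2, u_eq_one (j := m + 1) (Or.inr rfl)]
    · have e2 : adj (m + 1) j = j := by unfold adj; split_ifs <;> omega
      rw [if_neg h5, e2]
  · have e1 : adj k (m + 1) = m + 1 := by unfold adj; split_ifs <;> omega
    rw [if_neg h4, e1, u_eq_one (j := m + 1) (Or.inr rfl), div_one]


section Tuples

variable {E : Type*} [Field E]

theorem tab_zero (m : ℕ) (v : ℕ → ℕ → E) (i j : ℕ) : table' m 0 v i j = (v i j)⁻¹ := by
  simp [table']

theorem tab_row {m k : ℕ} (h : 0 < k) (h' : k < m) (v : ℕ → ℕ → E) (i j : ℕ) :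
    table' m k v i j = v (adj k i) j / v (adj k m) j := by
  unfold table'; rw [if_neg (by omega), if_pos h']

theorem tab_mid {m : ℕ} (hm : 1 < m) (v : ℕ → ℕ → E) (i j : ℕ) :
    table' m m v i j = if i = m ∨ j = m + 1 then 1 else 1 - v i j := by
  unfold table'; rw [if_neg (by omega), if_neg (by omega), if_pos rfl]

theorem tab_col {m k : ℕ} (h : m < k) (v : ℕ → ℕ → E) (i j : ℕ) :
    table' m k v i j = v i (adj k j) / v i (adj k (m + 1)) := by
  unfold table'; rw [if_neg (by omega), if_neg (by omega), if_neg (by omega)]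

theorem node_cases {m : ℕ} (k : ℕ) :
    k = 0 ∨ (0 < k ∧ k < m) ∨ k = m ∨ m < k := by omega

/-- The range of the extended coordinates. -/
def InRange (m n i j : ℕ) : Prop := 1 ≤ i ∧ i ≤ m ∧ m + 1 ≤ j ∧ j ≤ n

theorem inRange_row {m n i j k : ℕ} (h : InRange m n i j) (h0 : 0 < k) (hk : k < m) :
    InRange m n (adj k i) j := by
  unfold InRange adj at *; split_ifs <;> omega

theorem inRange_col {m n i j k : ℕ} (h : InRange m n i j) (h0 : m < k) (hk : k < n) :
    InRange m n i (adj k j) := by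
  unfold InRange adj at *; split_ifs <;> omega

theorem map_tab {F : Type*} [Field F] (φ : E →+* F) (m k : ℕ) (v : ℕ → ℕ → E) (i j : ℕ) :
    φ (table' m k v i j) = table' m k (fun i j => φ (v i j)) i j := by
  unfold table'
  by_cases h0 : k = 0
  · simp [h0]
  by_cases h1 : k < m
  · simp [h0, h1]
  by_cases h2 : k = m
  · rw [if_neg h0, if_neg h1, if_pos h2, if_neg h0, if_neg h1, if_pos h2]
    split_ifs <;> simp
  · simp [h0, h1, h2]

theorem tab_congr {m n k : ℕ} (hm : 1 < m) (hk : k < n) {v v' : ℕ → ℕ → E}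
    (h : ∀ i j, InRange m n i j → v i j = v' i j) (i j : ℕ) (hij : InRange m n i j) :
    table' m k v i j = table' m k v' i j := by
  rcases node_cases (m := m) k with rfl | ⟨h0, h1⟩ | rfl | h1
  · rw [tab_zero, tab_zero, h i j hij]
  · have hmj : InRange m n m j := by unfold InRange at *; omega
    rw [tab_row h0 h1, tab_row h0 h1, h _ _ (inRange_row hij h0 h1), h _ _ (inRange_row hmj h0 h1)]
  · rw [tab_mid hm, tab_mid hm, h i j hij]
  · have hmj : InRange m n i (m + 1) := by unfold InRange at *; omega
    rw [tab_col h1, tab_col h1, h _ _ (inRange_col hij h1 hk), h _ _ (inRange_col hmj h1 hk)]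

/-- The properties of the generic tuple of extended coordinates. -/
structure Generic (m n : ℕ) (v : ℕ → ℕ → E) : Prop where
  row : ∀ j, v m j = 1
  col : ∀ i, v i (m + 1) = 1
  ne_zero : ∀ i j, v i j ≠ 0
  one_sub : ∀ i j, 1 ≤ i → i < m → m + 1 < j → j ≤ n → 1 - v i j ≠ 0

theorem adj_adj (k i : ℕ) : adj k (adj k i) = i := by
  unfold adj; split_ifs <;> omega

theorem adj_comm {k l : ℕ} (h : k + 1 < l) (i : ℕ) : adj k (adj l i) = adj l (adj k i) := by
  unfold adj; split_ifs <;> omega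

theorem adj_braid (k i : ℕ) :
    adj k (adj (k + 1) (adj k i)) = adj (k + 1) (adj k (adj (k + 1) i)) := by
  unfold adj; split_ifs <;> omega

theorem adj_lt {k i : ℕ} (h : i < k) : adj k i = i := by
  unfold adj; split_ifs <;> omega

theorem adj_gt {k i : ℕ} (h : k + 1 < i) : adj k i = i := by
  unfold adj; split_ifs <;> omega

theorem adj_self (k : ℕ) : adj k k = k + 1 := by simp [adj]

theorem adj_succ (k : ℕ) : adj k (k + 1) = k := by simp [adj]

theorem tab_sq {m n k : ℕ} (hm : 1 < m) {v : ℕ → ℕ → E} (hv : Generic m n v)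
    (i j : ℕ) : table' m k (table' m k v) i j = v i j := by
  have := hv.ne_zero
  rcases node_cases (m := m) k with rfl | ⟨h0, h1⟩ | rfl | h1
  · simp only [tab_zero, inv_inv]
  · simp only [tab_row h0 h1, adj_adj, hv.row]
    field_simp [this]
  · simp only [tab_mid hm]
    split_ifs with h
    · rcases h with rfl | rfl
      · rw [hv.row]
      · rw [hv.col]
    · ring
  · simp only [tab_col h1, adj_adj, hv.col]
    field_simp [this]

theorem tab_comm {m n k l : ℕ} (hm : 1 < m) {v : ℕ → ℕ → E} (hv : Generic m n v)
    (hkl : k < l) (hJ : ¬ Joined m k l) (i j : ℕ) :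
    table' m k (table' m l v) i j = table' m l (table' m k v) i j := by
  have := hv.ne_zero
  have hJ' : ¬ (k = 0 ∧ l = m) ∧ ¬ (1 ≤ k ∧ l = k + 1) := by unfold Joined at hJ; omega
  obtain ⟨j1, j2⟩ := hJ'
  rcases node_cases (m := m) k with h0 | ⟨h0, h1⟩ | h0 | h1 <;>
  rcases node_cases (m := m) l with g0 | ⟨g0, g1⟩ | g0 | g1 <;> try omega
  · subst h0
    simp only [tab_zero, tab_row g0 g1]
    field_simp [this]
  · subst h0
    simp only [tab_zero, tab_col g1]
    field_simp [this]
  · have e : k + 1 < l := by omega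
    simp only [tab_row h0 h1, tab_row g0 g1, adj_comm e]
    field_simp [this]
  · subst g0
    have e : k + 1 < l := by omega
    have e' : adj k i = l ↔ i = l := by unfold adj; split_ifs <;> omega
    simp only [tab_row h0 h1, tab_mid hm, adj_gt e, hv.row, true_or, if_true, div_one, e']
  · simp only [tab_row h0 h1, tab_col g1]
    field_simp [this]
  · subst h0
    have e : k + 1 < l := by omega
    have e' : adj l j = k + 1 ↔ j = k + 1 := by unfold adj; split_ifs <;> omega
    simp only [tab_mid hm, tab_col g1, adj_lt e, hv.col, or_true, if_true, div_one, e']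
  · have e : k + 1 < l := by omega
    simp only [tab_col h1, tab_col g1, adj_comm e]
    field_simp [this]

theorem tab_braid {m n k l : ℕ} (hm : 1 < m) {v : ℕ → ℕ → E} (hv : Generic m n v)
    (hkl : k < l) (hl : l < n) (hJ : Joined m k l) (i j : ℕ)
    (hij : 1 ≤ i ∧ i < m ∧ m + 1 < j ∧ j ≤ n) :
    table' m k (table' m l (table' m k v)) i j = table' m l (table' m k (table' m l v)) i j := by
  have := hv.ne_zero
  have h1v := hv.one_sub
  rcases node_cases (m := m) k with rfl | ⟨h0, h1⟩ | rfl | h1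
  · obtain rfl : l = m := by unfold Joined at hJ; omega
    have n1 : ¬ (i = l ∨ j = l + 1) := by omega
    have a1 := h1v i j hij.1 hij.2.1 hij.2.2.1 hij.2.2.2
    have a2 : v i j - 1 ≠ 0 := fun h => a1 (by linear_combination -h)
    simp only [tab_zero, tab_mid hm, if_neg n1]
    have := this i j
    field_simp
    ring
  · obtain rfl : l = k + 1 := by unfold Joined at hJ; omega
    by_cases h2 : k + 1 < m
    · simp only [tab_row h0 h1, tab_row (Nat.succ_pos k) h2, adj_braid]
      field_simp [this]
    · obtain rfl : m = k + 1 := by omega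
      have n1 : ¬ (i = k + 1 ∨ j = k + 1 + 1) := by omega
      have n2 : ¬ (k = k + 1 ∨ j = k + 1 + 1) := by omega
      have b1 := h1v k j h0 h1 hij.2.2.1 hij.2.2.2
      have b2 : v k j - 1 ≠ 0 := fun h => b1 (by linear_combination -h)
      by_cases h3 : i = k
      · subst h3
        simp only [tab_row h0 h1, tab_mid hm, if_neg n1, adj_self, adj_succ, hv.row, true_or,
          if_true]
        have := this i j
        field_simp
        ring
      · have e : adj k i = i := adj_lt (by omega)
        simp only [tab_row h0 h1, tab_mid hm, if_neg n1, if_neg n2, adj_self, adj_succ, hv.row,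
          e]
        have := this k j
        field_simp
        ring
  · obtain rfl : l = k + 1 := by unfold Joined at hJ; omega
    have n1 : ¬ (i = k ∨ j = k + 1) := by omega
    have n2 : ¬ (i = k ∨ k + 1 + 1 = k + 1) := by omega
    have b1 := h1v i (k + 2) hij.1 hij.2.1 (by omega) (by omega)
    have b2 : v i (k + 2) - 1 ≠ 0 := fun h => b1 (by linear_combination -h)
    by_cases h3 : j = k + 2
    · subst h3
      simp only [tab_col (Nat.lt_succ_self k), tab_mid hm, if_neg n1, adj_self, adj_succ, hv.col,
        or_true, if_true]
      have := this i (k + 2)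
      field_simp
      ring
    · have e : adj (k + 1) j = j := adj_gt (by omega)
      simp only [tab_col (Nat.lt_succ_self k), tab_mid hm, if_neg n1, if_neg n2, adj_self,
        adj_succ, hv.col, e]
      have := this i (k + 2)
      field_simp
      ring
  · obtain rfl : l = k + 1 := by unfold Joined at hJ; omega
    simp only [tab_col h1, tab_col (Nat.lt_succ_of_lt h1), adj_braid]
    field_simp [this]

end Tuples

theorem generic_u (m n : ℕ) : Generic m n (u m n) where
  row _ := u_eq_one (Or.inl rfl)
  col _ := u_eq_one (Or.inr rfl)
  ne_zero := u_ne_zero m n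
  one_sub _ _ h1 h2 h3 h4 := one_sub_u_ne_zero ⟨h1, h2, h3, h4⟩

/-- The values of the table at the coordinates. -/
noncomputable def tableVal (m n k : ℕ) (p : Idx m n) : KX m n := table m k (u m n) p.1.1 p.1.2

theorem tab_mem {m n k : ℕ} (hm : 1 < m) (hk : k < n) (F : IntermediateField ℂ (KX m n))
    {v : ℕ → ℕ → KX m n} (h : ∀ i j, InRange m n i j → v i j ∈ F) (i j : ℕ)
    (hij : InRange m n i j) : table' m k v i j ∈ F := by
  rcases node_cases (m := m) k with rfl | ⟨h0, h1⟩ | rfl | h1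
  · rw [tab_zero]; exact F.inv_mem (h i j hij)
  · have hmj : InRange m n m j := by unfold InRange at *; omega
    rw [tab_row h0 h1]
    exact F.div_mem (h _ _ (inRange_row hij h0 h1)) (h _ _ (inRange_row hmj h0 h1))
  · rw [tab_mid hm]
    split_ifs
    · exact F.one_mem
    · exact F.sub_mem F.one_mem (h i j hij)
  · have hmj : InRange m n i (m + 1) := by unfold InRange at *; omega
    rw [tab_col h1]
    exact F.div_mem (h _ _ (inRange_col hij h1 hk)) (h _ _ (inRange_col hmj h1 hk))

theorem tab_bdry {m n k i j : ℕ} (hm : 1 < m) (h : i = m ∨ j = m + 1) :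
    table' m k (u m n) i j = 1 := by
  rcases node_cases (m := m) k with rfl | ⟨h0, h1⟩ | rfl | h1
  · rw [tab_zero, u_eq_one h, inv_one]
  · rw [tab_row h0 h1]
    rcases h with rfl | rfl
    · exact div_self (u_ne_zero _ _ _ _)
    · rw [u_eq_one (Or.inr rfl), u_eq_one (Or.inr rfl), div_one]
  · rw [tab_mid hm, if_pos h]
  · rw [tab_col h1]
    rcases h with rfl | rfl
    · rw [u_eq_one (Or.inl rfl), u_eq_one (Or.inl rfl), div_one]
    · exact div_self (u_ne_zero _ _ _ _)

theorem X_eq_u {m n : ℕ} (p : Idx m n) :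
    algebraMap (MvPolynomial (Idx m n) ℂ) (KX m n) (MvPolynomial.X p) = u m n p.1.1 p.1.2 := by
  unfold u; rw [dif_pos p.2]

theorem adjoin_tableVal {m n k : ℕ} (hm : 1 < m) (hk : k < n) :
    IntermediateField.adjoin ℂ (Set.range (tableVal m n k)) = ⊤ := by
  set F := IntermediateField.adjoin ℂ (Set.range (tableVal m n k)) with hF
  have h1 : ∀ i j, InRange m n i j → table' m k (u m n) i j ∈ F := by
    intro i j hij
    by_cases hb : i = m ∨ j = m + 1
    · rw [tab_bdry hm hb]; exact F.one_mem
    · have hij' : 1 ≤ i ∧ i + 1 ≤ m ∧ m + 2 ≤ j ∧ j ≤ n := by unfold InRange at hij; omega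
      rw [← table_eq hk hij']
      exact IntermediateField.subset_adjoin _ _ ⟨⟨(i, j), hij'⟩, rfl⟩
  have h2 : ∀ i j, InRange m n i j → u m n i j ∈ F := by
    intro i j hij
    rw [← tab_sq (k := k) hm (generic_u m n) i j]
    exact tab_mem hm hk F h1 i j hij
  have h3 : ∀ p : MvPolynomial (Idx m n) ℂ, algebraMap _ (KX m n) p ∈ F := by
    intro p
    induction p using MvPolynomial.induction_on with
    | C a =>
      have : algebraMap (MvPolynomial (Idx m n) ℂ) (KX m n) (MvPolynomial.C a) =
          algebraMap ℂ (KX m n) a := by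
        rw [← MvPolynomial.algebraMap_eq, ← IsScalarTower.algebraMap_apply]
      rw [this]; exact F.algebraMap_mem a
    | add p q hp hq => rw [map_add]; exact F.add_mem hp hq
    | mul_X p i hp =>
      rw [map_mul, X_eq_u]
      refine F.mul_mem hp (h2 _ _ ?_)
      have := i.2
      unfold InRange; omega
  refine eq_top_iff.2 fun x _ => ?_
  obtain ⟨a, b, -, rfl⟩ := IsFractionRing.div_surjective (MvPolynomial (Idx m n) ℂ) x
  exact F.div_mem (h3 a) (h3 b)

theorem algebraicIndependent_tableVal {m n k : ℕ} (hm : 1 < m) (hk : k < n) :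
    AlgebraicIndependent ℂ (tableVal m n k) := by
  have hfr : IsFractionRing (Algebra.adjoin ℂ (Set.range (tableVal m n k))) (KX m n) := by
    refine IsFractionRing.of_field _ _ fun z => ?_
    have hz : z ∈ IntermediateField.adjoin ℂ (Set.range (tableVal m n k)) := by
      rw [adjoin_tableVal hm hk]; trivial
    obtain ⟨x, hx, y, hy, e⟩ := IntermediateField.mem_adjoin_iff_div.1 hz
    exact ⟨⟨x, hx⟩, ⟨y, hy⟩, e⟩
  have halg : Algebra.IsAlgebraic (Algebra.adjoin ℂ (Set.range (tableVal m n k))) (KX m n) :=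
    IsLocalization.isAlgebraic _ (nonZeroDivisors _)
  have halg' : Algebra.IsAlgebraic (MvPolynomial (Idx m n) ℂ) (KX m n) :=
    IsLocalization.isAlgebraic _ (nonZeroDivisors _)
  have htr := ((IsTranscendenceBasis.mvPolynomial (Idx m n) ℂ).algebraMap_comp
    (A := KX m n)).cardinalMk_eq_trdeg
  exact (Algebra.IsAlgebraic.isTranscendenceBasis_of_le_trdeg_of_finite ℂ _ htr.le).1

/-- The automorphism `s_k` of `𝒦(𝕏_{m,n})`, given by the substitution `u_{i,j} ↦ s_k(u_{i,j})`. -/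
noncomputable def sub (m n k : ℕ) (hm : 1 < m) (hk : k < n) : KX m n →ₐ[ℂ] KX m n :=
  IsFractionRing.liftAlgHom (g := MvPolynomial.aeval (tableVal m n k))
    (algebraicIndependent_iff_injective_aeval.1 (algebraicIndependent_tableVal hm hk))

theorem sub_u {m n k : ℕ} (hm : 1 < m) (hk : k < n) {i j : ℕ}
    (hij : 1 ≤ i ∧ i + 1 ≤ m ∧ m + 2 ≤ j ∧ j ≤ n) :
    sub m n k hm hk (u m n i j) = table m k (u m n) i j := by
  have := X_eq_u (m := m) (n := n) ⟨(i, j), hij⟩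
  dsimp only at this
  rw [← this, sub, IsFractionRing.liftAlgHom_apply, IsFractionRing.lift_algebraMap]
  exact MvPolynomial.aeval_X _ _

theorem sub_u' {m n k : ℕ} (hm : 1 < m) (hk : k < n) (i j : ℕ) (hij : InRange m n i j) :
    sub m n k hm hk (u m n i j) = table' m k (u m n) i j := by
  by_cases hb : i = m ∨ j = m + 1
  · rw [tab_bdry hm hb, u_eq_one hb, map_one]
  · have hij' : 1 ≤ i ∧ i + 1 ≤ m ∧ m + 2 ≤ j ∧ j ≤ n := by unfold InRange at hij; omega
    rw [sub_u hm hk hij', table_eq hk hij']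

theorem algHom_ext_u {m n : ℕ} {φ ψ : KX m n →ₐ[ℂ] KX m n}
    (h : ∀ i j, 1 ≤ i ∧ i + 1 ≤ m ∧ m + 2 ≤ j ∧ j ≤ n → φ (u m n i j) = ψ (u m n i j)) :
    φ = ψ := by
  refine IsLocalization.algHom_ext (nonZeroDivisors (MvPolynomial (Idx m n) ℂ)) ?_
  refine MvPolynomial.algHom_ext fun p => ?_
  have := h p.1.1 p.1.2 p.2
  rw [← X_eq_u] at this
  exact this

/-- The left action of `W_{m,n}` on `𝒦(𝕏_{m,n})` by field automorphisms. -/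
noncomputable def fieldAct (m n : ℕ) (hm : 1 < m) : W m n →* (KX m n →ₐ[ℂ] KX m n) :=
  (coxeterMatrix m n).toCoxeterSystem.lift
    ⟨fun k => sub m n k hm k.2, by
      have G := generic_u m n
      have two : ∀ (k l : Fin n) (i j : ℕ), InRange m n i j →
          sub m n k hm k.2 (sub m n l hm l.2 (u m n i j)) =
            table' m l (table' m k (u m n)) i j := by
        intro k l i j hij
        rw [sub_u' hm l.2 i j hij]
        refine (map_tab (sub m n k hm k.2 : KX m n →+* KX m n) m l (u m n) i j).trans ?_
        exact tab_congr hm l.2 (fun i j h => sub_u' hm k.2 i j h) i j hij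
      have three : ∀ (k l r : Fin n) (i j : ℕ), InRange m n i j →
          sub m n k hm k.2 (sub m n l hm l.2 (sub m n r hm r.2 (u m n i j))) =
            table' m r (table' m l (table' m k (u m n))) i j := by
        intro k l r i j hij
        rw [sub_u' hm r.2 i j hij]
        refine (congrArg _ (map_tab (sub m n l hm l.2 : KX m n →+* KX m n) m r (u m n) i j)).trans ?_
        refine (map_tab (sub m n k hm k.2 : KX m n →+* KX m n) m r _ i j).trans ?_
        exact tab_congr hm r.2 (fun i j h => two k l i j h) i j hij
      refine isLiftable_of_relations m n _ ?_ ?_ ?_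
      · intro k
        refine algHom_ext_u fun i j hij => ?_
        have hr : InRange m n i j := by unfold InRange; omega
        exact (two k k i j hr).trans (tab_sq hm G i j)
      · intro k l hkl hJ
        refine algHom_ext_u fun i j hij => ?_
        have hr : InRange m n i j := by unfold InRange; omega
        refine (two k l i j hr).trans (Eq.trans ?_ (two l k i j hr).symm)
        rcases lt_or_gt_of_ne (fun hh => hkl (Fin.ext hh) : (k : ℕ) ≠ l) with hlt | hlt
        · exact (tab_comm hm G hlt hJ i j).symm
        · exact tab_comm hm G hlt (by unfold Joined at *; omega) i j
      · intro k l hJ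
        refine algHom_ext_u fun i j hij => ?_
        have hr : InRange m n i j := by unfold InRange; omega
        have hij' : 1 ≤ i ∧ i < m ∧ m + 1 < j ∧ j ≤ n := by omega
        refine (three k l k i j hr).trans (Eq.trans ?_ (three l k l i j hr).symm)
        rcases lt_or_gt_of_ne (by unfold Joined at hJ; omega : (k : ℕ) ≠ l) with hlt | hlt
        · exact tab_braid hm G hlt l.2 hJ i j hij'
        · exact (tab_braid hm G hlt k.2 (by unfold Joined at *; omega) i j hij').symm⟩

theorem fieldAct_s {m n : ℕ} (hm : 1 < m) (k : Fin n) {i j : ℕ}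
    (hij : 1 ≤ i ∧ i + 1 ≤ m ∧ m + 2 ≤ j ∧ j ≤ n) :
    fieldAct m n hm (s m n k) (u m n i j) = table m k (u m n) i j := by
  rw [← sub_u hm k.2 hij]
  exact DFunLike.congr_fun
    ((coxeterMatrix m n).toCoxeterSystem.lift_apply_simple (f := fun k : Fin n => sub m n k hm k.2)
      _ k) _

/-- The inclusion `𝒦(𝕏_{m,n}) ⊂ 𝒦(𝕏_{m,n+1})` induced by the projection `𝕏_{m,n+1} → 𝕏_{m,n}`
that forgets the last point, `u_{i,j} ↦ u_{i,j}`. -/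
noncomputable def inclK (m n : ℕ) : KX m n →ₐ[ℂ] KX m (n + 1) :=
  IsFractionRing.liftAlgHom
    (g := (IsScalarTower.toAlgHom ℂ (MvPolynomial (Idx m (n + 1)) ℂ) (KX m (n + 1))).comp
      (MvPolynomial.rename fun p : Idx m n =>
        (⟨p.1, p.2.1, p.2.2.1, p.2.2.2.1, p.2.2.2.2.trans n.le_succ⟩ : Idx m (n + 1))))
    ((IsFractionRing.injective (MvPolynomial (Idx m (n + 1)) ℂ) (KX m (n + 1))).comp
      (MvPolynomial.rename_injective _ fun _ _ hpq => Subtype.ext (Subtype.mk.inj hpq)))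

/-- The homogeneous coordinates `(z₁ : ⋯ : z_{m-1} : 1)` of the general point `q = p_{n+1}`,
as elements of `𝒦(𝕏_{m,n+1})`. -/
noncomputable def z (m n i : ℕ) : KX m (n + 1) := u m (n + 1) i (n + 1)

/-! ### Linear systems of forms with assigned multiplicities -/

/-- The index set `{1, …, m}` of the homogeneous coordinates. -/
abbrev Coord (m : ℕ) : Type := {i : ℕ // 1 ≤ i ∧ i ≤ m}

/-- The polynomial `f` vanishes to order `≥ ν` at the point `p` of the affine space `K^m`:
the Taylor expansion of `f` at `p` has no term of degree `< ν`. For a form `f` and `p ≠ 0` this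
says that `f` has a zero of multiplicity `≥ ν` at the point of the projective space given by `p`.
There is no condition when `ν ≤ 0`. -/
def VanishesToOrder {m : ℕ} {K : Type*} [Field K] (f : MvPolynomial (Coord m) K) (p : Coord m → K)
    (ν : ℤ) : Prop :=
  ∀ t : Coord m →₀ ℕ, (t.degree : ℤ) < ν →
    (MvPolynomial.aeval (fun i => MvPolynomial.X i + MvPolynomial.C (p i)) f :
      MvPolynomial (Coord m) K).coeff t = 0

/-- Homogeneous coordinates of `p_j` (`1 ≤ j ≤ n`) in the coordinate system `x` of
`ℙ^{m-1}(𝒦(𝕏_{m,n}))` with `(z₁ : ⋯ : z_{m-1} : 1) = (a₁x₁ : ⋯ : a_mx_m)`: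
in the coordinates `(z₁ : ⋯ : z_{m-1} : 1)`, the points `p₁, …, p_m` are the coordinate points,
`p_{m+1} = (1 : ⋯ : 1)` and `p_j = (u_{1,j} : ⋯ : u_{m-1,j} : 1)` for `j ≥ m+2`. -/
noncomputable def pt {m n : ℕ} (a : Coord m → KX m n) (j : ℕ) (i : Coord m) : KX m n :=
  (if j ≤ m then (if (i : ℕ) = j then 1 else 0) else u m n i j) / a i

/-- The inclusion of `𝒦(𝕏_{m,n})` into an extension field of `𝒦(𝕏_{m,n+1})`. -/
noncomputable def incl (m n : ℕ) (E : Type*) [Field E] [Algebra (KX m (n + 1)) E] : KX m n →+* E :=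
  (algebraMap (KX m (n + 1)) E).comp (inclK m n : KX m n →+* KX m (n + 1))

/-- Two coordinate vectors define the same point of the projective space: they are nonzero and
proportional. -/
def SamePoint {m : ℕ} {E : Type*} [Field E] (v v' : Coord m → E) : Prop :=
  v ≠ 0 ∧ v' ≠ 0 ∧ ∃ r : E, r ≠ 0 ∧ ∀ i, v' i = r * v i

/-- For `Λ = d e₀ - ν₁ e₁ - ⋯ - ν_n e_n`, the space `L(Λ)` of homogeneous polynomials of degree `d`
in `x₁, …, x_m` over `𝒦(𝕏_{m,n})` (including `0`) that have a zero of multiplicity `≥ ν_j` at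
`p_j` for `j = 1, …, n`. -/
noncomputable def L {m n : ℕ} (a : Coord m → KX m n) (Λ : Lat n) :
    Submodule (KX m n) (MvPolynomial (Coord m) (KX m n)) where
  carrier := {f | (∀ t, f.coeff t ≠ 0 → (t.degree : ℤ) = Λ 0) ∧
    ∀ j : Fin n, VanishesToOrder f (pt a (j + 1)) (-Λ j.succ)}
  zero_mem' := by simp [VanishesToOrder]
  add_mem' := by
    rintro f g ⟨hf, hf'⟩ ⟨hg, hg'⟩
    refine ⟨fun t ht => ?_, fun j t ht => ?_⟩
    · by_cases h : f.coeff t = 0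
      · exact hg t (by rwa [MvPolynomial.coeff_add, h, zero_add] at ht)
      · exact hf t h
    · rw [map_add, MvPolynomial.coeff_add, hf' j t ht, hg' j t ht, add_zero]
  smul_mem' := by
    rintro c f ⟨hf, hf'⟩
    refine ⟨fun t ht => hf t fun h => ht ?_, fun j t ht => ?_⟩
    · rw [MvPolynomial.coeff_smul, h, smul_zero]
    · rw [map_smul, MvPolynomial.coeff_smul, hf' j t ht, smul_zero]

/-- The orbit `M_{m,n} = W_{m,n}{e₁, …, e_n}` in `L_{m,n}`. -/
def M (m n : ℕ) (hn : m < n) : Set (Lat n) :=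
  {Λ | ∃ (w : W m n) (j : ℕ), 1 ≤ j ∧ j ≤ n ∧ Λ = latAct m n hn w (e n j)}

end PointConfig

namespace PointConfig

open MvPolynomial

/-! A form `f` in `L a Λ` is studied through its value `genVal a f` at the general point x_i = z_i /
a_i, an element of the larger function field. No information is lost: one coordinate of the general
point is 1 and the others are independent variables, so a nonzero form cannot vanish there
(`eval₂_z_ne_zero`, `genVal_injOn`).

The central fact is `exists_transport`: applying s_k to the value of an element of L(Λ) gives ρ(Λ)
times the value of an element of L(s_k.Λ), where the nonzero factor ρ is multiplicative in Λ. For k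
≥ 1 this holds because s_k is induced by a linear change of coordinates that permutes the points.
For k = 0 it is the classical behaviour of degree and multiplicities under the standard Cremona
transformation (`exists_mem_L_of_cremona`).

Since s_k is an involution, transport carries a generator of a one-dimensional L(Λ) to a generator
of L(s_k.Λ). As L(e_j) consists of the constants, induction on a word for w gives dimension one on
the whole orbit.

For the second statement, 1 lies in L(e_i), and z_i is the value of a form in L(s₀.e_i).
Transporting this pair along w gives w(z_i) · F_i = r · G_i at the general point. The factor r is
the same for all i because w s₀.e_i - w.e_i = w.h₀ does not depend on i (`exists_forms`). Dimension
one then shows that any other choice of F_i and G_i changes these forms only by constants. -/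

instance (m : ℕ) : Fintype (Coord m) :=
  Fintype.subtype (Finset.Icc 1 m) fun i => by simp

/-! ### Homogeneous polynomials and orders of vanishing -/

theorem eval₂_mul_of_isHomogeneous {σ R S : Type*} [CommSemiring R] [CommSemiring S]
    {f : MvPolynomial σ R} {d : ℕ} (hf : f.IsHomogeneous d) (g : R →+* S) (c : S) (x : σ → S) :
    f.eval₂ g (fun i => c * x i) = c ^ d * f.eval₂ g x := by
  rw [eval₂_eq, eval₂_eq, Finset.mul_sum]
  refine Finset.sum_congr rfl fun t ht => ?_
  rw [hf.degree_eq_sum_deg_support ht]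
  simp only [mul_pow, Finset.prod_mul_distrib, Finset.prod_pow_eq_pow_sum]
  ring

/-- Setting the `i`-th variable of a homogeneous polynomial equal to a constant does not
superpose monomials. -/
theorem coeff_dehomogenize {σ R : Type*} [CommSemiring R] [DecidableEq σ]
    {f : MvPolynomial σ R} {d : ℕ} (hf : f.IsHomogeneous d) (i : σ) (c : R) (t : σ →₀ ℕ)
    (ht : t.degree = d) :
    (f.eval₂ C (Function.update X i (C c)) : MvPolynomial σ R).coeff (t.erase i) =
      c ^ t i * f.coeff t := by
  have key : ∀ s : σ →₀ ℕ, (∏ j ∈ s.support, (Function.update X i (C c) : σ → MvPolynomial σ R) j ^ s j)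
      = monomial (s.erase i) (c ^ s i) := by
    intro s
    rw [← Finsupp.prod, ← Finsupp.mul_prod_erase' s i _ (by simp), Function.update_self,
      monomial_eq, C_pow]
    congr 1
    refine Finsupp.prod_congr fun j hj => ?_
    rw [Function.update_of_ne]
    rintro rfl
    simp at hj
  -- In a fixed total degree the exponent of the `i`-th variable is recovered from the other
  -- exponents.
  have inj : ∀ s : σ →₀ ℕ, s.degree = d → s.erase i = t.erase i → s = t := by
    intro s hs he
    have h1 : ∀ r : σ →₀ ℕ, r.degree = (r.erase i).degree + r i := by
      intro r
      conv_lhs => rw [← Finsupp.erase_add_single i r]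
      simp
    have h2 : s i = t i := by
      have a1 := h1 s
      have a2 := h1 t
      rw [he] at a1
      omega
    rw [← Finsupp.erase_add_single i s, ← Finsupp.erase_add_single i t, he, h2]
  rw [eval₂_eq, coeff_sum]
  simp only [key, C_mul_monomial, coeff_monomial]
  rw [Finset.sum_eq_single t]
  · rw [if_pos rfl, mul_comm]
  · intro s hs hst
    rw [if_neg]
    intro he
    exact hst (inj s (by
      have := hf.degree_eq_sum_deg_support hs
      rw [Finsupp.degree_apply, ← this]) he)
  · intro h
    rw [notMem_support_iff.1 h]
    simp

theorem dehomogenize_ne_zero {σ R : Type*} [CommSemiring R] [DecidableEq σ]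
    {f : MvPolynomial σ R} {d : ℕ} (hf : f.IsHomogeneous d) (h0 : f ≠ 0) (i : σ) :
    (f.eval₂ C (Function.update X i 1) : MvPolynomial σ R) ≠ 0 := by
  obtain ⟨t, ht⟩ := ne_zero_iff.1 h0
  intro h
  have := coeff_dehomogenize hf i 1 t (hf.degree_eq_sum_deg_support (mem_support_iff.2 ht)).symm
  rw [C_1, h] at this
  simp at this
  exact ht this.symm

theorem ideal_pow_map {R S : Type*} [CommSemiring R] [CommSemiring S] (φ : R →+* S) {I : Ideal R}
    {J : Ideal S} (h : ∀ x ∈ I, φ x ∈ J) {n : ℕ} {x : R} (hx : x ∈ I ^ n) : φ x ∈ J ^ n := by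
  have h1 : I.map φ ≤ J := Ideal.map_le_iff_le_comap.2 h
  refine Ideal.pow_right_mono h1 n ?_
  rw [← Ideal.map_pow]
  exact Ideal.mem_map_of_mem _ hx

theorem mem_idealOfVars_iff_eval {σ K : Type*} [Field K] (f : MvPolynomial σ K) :
    f ∈ idealOfVars σ K ↔ eval (0 : σ → K) f = 0 := by
  have := mem_pow_idealOfVars_iff' 1 f
  rw [pow_one] at this
  have e : eval (0 : σ → K) f = coeff 0 f := by simp [constantCoeff_eq]
  rw [this, e]
  constructor
  · intro h; exact h 0 (by simp)
  · intro h x hx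
    have : x = 0 := by
      rwa [Nat.lt_one_iff, Finsupp.degree_eq_zero_iff] at hx
    rw [this]; exact h

/-- A polynomial vanishes to order `≥ ν` at `p` if and only if it lies in the `ν`-th power of the
maximal ideal of `p`. -/
theorem vanishesToOrder_iff {m : ℕ} {K : Type*} [Field K] {f : MvPolynomial (Coord m) K}
    {p : Coord m → K} {ν : ℤ} :
    VanishesToOrder f p ν ↔ f ∈ RingHom.ker (eval p) ^ ν.toNat := by
  -- The translations `τ` and `τ'` exchange the maximal ideals of `p` and of the origin. At the
  -- origin, membership in a power of the ideal is read off the coefficients.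
  set τ : MvPolynomial (Coord m) K →ₐ[K] MvPolynomial (Coord m) K := aeval (fun i => X i + C (p i))
    with hτ
  set τ' : MvPolynomial (Coord m) K →ₐ[K] MvPolynomial (Coord m) K := aeval (fun i => X i - C (p i))
    with hτ'
  have h1 : ∀ g, eval (0 : Coord m → K) (τ g) = eval p g := by
    intro g
    induction g using MvPolynomial.induction_on with
    | C a => simp
    | add p q hp hq => rw [map_add, map_add, hp, hq, map_add]
    | mul_X q i hq => rw [map_mul, map_mul, hq, map_mul]; simp [hτ]
  have h2 : ∀ g, eval p (τ' g) = eval (0 : Coord m → K) g := by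
    intro g
    induction g using MvPolynomial.induction_on with
    | C a => simp
    | add p q hp hq => simp [hp, hq]
    | mul_X q i hq => rw [map_mul, map_mul, hq, map_mul]; simp [hτ']
  have h3 : ∀ g, τ' (τ g) = g := by
    intro g
    induction g using MvPolynomial.induction_on with
    | C a => simp
    | add p q hp hq => simp [hp, hq]
    | mul_X q i hq => rw [map_mul, map_mul, hq]; simp [hτ, hτ']
  have h4 : VanishesToOrder f p ν ↔ τ f ∈ idealOfVars (Coord m) K ^ ν.toNat := by
    rw [mem_pow_idealOfVars_iff']
    simp only [VanishesToOrder, Int.lt_toNat]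
    rfl
  rw [h4]
  constructor
  · intro h
    rw [← h3 f]
    refine ideal_pow_map τ'.toRingHom (fun x hx => ?_) h
    rw [mem_idealOfVars_iff_eval] at hx
    exact RingHom.mem_ker.2 ((h2 x).trans hx)
  · intro h
    refine ideal_pow_map τ.toRingHom (fun x hx => ?_) h
    rw [mem_idealOfVars_iff_eval]
    exact (h1 x).trans (RingHom.mem_ker.1 hx)

/-- A semilinear substitution that takes `q` to σ(p) pulls the maximal ideal of `p` back into that
of `q`, hence also its powers. -/
theorem VanishesToOrder.map {m : ℕ} {K : Type*} [Field K] {f : MvPolynomial (Coord m) K}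
    {p : Coord m → K} {ν : ℤ} (hf : VanishesToOrder f p ν) (σ : K →+* K)
    (A : Coord m → MvPolynomial (Coord m) K) (q : Coord m → K)
    (h : ∀ i, eval q (A i) = σ (p i)) : VanishesToOrder (f.eval₂ (C.comp σ) A) q ν := by
  rw [vanishesToOrder_iff] at hf ⊢
  refine ideal_pow_map (eval₂Hom (C.comp σ) A) (fun x hx => ?_) hf
  rw [RingHom.mem_ker] at hx ⊢
  have : (eval q).comp (eval₂Hom (C.comp σ) A) = σ.comp (eval p) := by
    refine MvPolynomial.ringHom_ext (fun a => ?_) fun i => ?_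
    · simp
    · simp [h]
  have := RingHom.congr_fun this x
  simp only [RingHom.comp_apply] at this
  rw [this, hx, map_zero]

/-- For a form, vanishing at a point and at a multiple of it are equivalent. -/
theorem VanishesToOrder.map_smul {m : ℕ} {K : Type*} [Field K] {f : MvPolynomial (Coord m) K}
    {d : ℕ} (hd : f.IsHomogeneous d)
    {p : Coord m → K} {ν : ℤ} (hf : VanishesToOrder f p ν) (σ : K →+* K)
    (A : Coord m → MvPolynomial (Coord m) K) (q : Coord m → K) (c : K) (hc : c ≠ 0)
    (h : ∀ i, σ (p i) = c * eval q (A i)) : VanishesToOrder (f.eval₂ (C.comp σ) A) q ν := by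
  -- After rescaling by `c` the substitution meets the point exactly. Homogeneity then extracts the
  -- unit c^d.
  have h1 := hf.map σ (fun i => C c * A i) q fun i => by simp [h]
  rw [eval₂_mul_of_isHomogeneous hd] at h1
  rw [vanishesToOrder_iff] at h1 ⊢
  have := Ideal.mul_mem_left _ (C (c⁻¹ ^ d)) h1
  rwa [← mul_assoc, ← C_pow, ← C_mul, ← mul_pow, inv_mul_cancel₀ hc, one_pow, C_1, one_mul] at this

/-- If f(p) ≠ 0, then `f` is a unit modulo every power of the maximal ideal of `p`: it is coprime to
the powers of f(p) - f, which lies in that ideal. -/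
theorem VanishesToOrder.of_mul {m : ℕ} {K : Type*} [Field K] {f g : MvPolynomial (Coord m) K}
    {p : Coord m → K} {ν : ℤ} (h : VanishesToOrder (f * g) p ν) (hf : eval p f ≠ 0) :
    VanishesToOrder g p ν := by
  rw [vanishesToOrder_iff] at h ⊢
  have hc : IsCoprime (f ^ 1) ((C (eval p f) - f) ^ ν.toNat) := by
    refine IsCoprime.pow ⟨C (eval p f)⁻¹, C (eval p f)⁻¹, ?_⟩
    rw [mul_sub, ← C_mul, inv_mul_cancel₀ hf, C_1]; ring
  obtain ⟨a, b, hab⟩ := hc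
  have h1 : (C (eval p f) - f) ^ ν.toNat ∈ RingHom.ker (eval p) ^ ν.toNat :=
    Ideal.pow_mem_pow (by simp [RingHom.mem_ker]) _
  have : g = a * (f * g) + (b * g) * (C (eval p f) - f) ^ ν.toNat := by
    linear_combination -g * hab
  rw [this]
  exact add_mem (Ideal.mul_mem_left _ _ h) (Ideal.mul_mem_left _ _ h1)

theorem VanishesToOrder.of_nonpos {m : ℕ} {K : Type*} [Field K] (f : MvPolynomial (Coord m) K)
    (p : Coord m → K) {ν : ℤ} (h : ν ≤ 0) : VanishesToOrder f p ν := fun t ht => by omega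

/-- A form of degree `d` vanishes to order `≥ ν` at the `i`-th coordinate point if and only if its
degree in the `i`-th variable is at most `d - ν`. -/
theorem vanishesToOrder_single_iff {m : ℕ} {K : Type*} [Field K] {f : MvPolynomial (Coord m) K}
    {d : ℕ} (hd : f.IsHomogeneous d) (i : Coord m) (ν : ℤ) :
    VanishesToOrder f (Pi.single i 1) ν ↔ ∀ t, f.coeff t ≠ 0 → (t i : ℤ) + ν ≤ d := by
  have hdeg : ∀ t, f.coeff t ≠ 0 → t.degree = d := fun t ht =>
    (hd.degree_eq_sum_deg_support (mem_support_iff.2 ht)).symm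
  constructor
  · intro h t ht
    -- In the affine chart X_i = 1 the coordinate point is the origin, and the coefficients of the
    -- dehomogenized form are those of `f`.
    have h1 := h.map (RingHom.id K) (Function.update X i (C 1)) 0 fun j => by
      by_cases hj : j = i
      · subst hj; simp
      · simp [hj]
    rw [RingHom.comp_id] at h1
    by_contra hlt
    have h2 := h1 (t.erase i) (by
      have : t.degree = (t.erase i).degree + t i := by
        conv_lhs => rw [← Finsupp.erase_add_single i t]
        simp
      have := hdeg t ht
      omega)
    have h3 : (aeval fun j => X j + C ((0 : Coord m → K) j)) (eval₂ C (Function.update X i (C 1)) f)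
        = (eval₂ C (Function.update X i (C 1)) f : MvPolynomial (Coord m) K) := by
      simp
    rw [h3, coeff_dehomogenize hd i 1 t (hdeg t ht)] at h2
    simp at h2
    exact ht h2
  · intro h
    rw [vanishesToOrder_iff, f.as_sum]
    refine Ideal.sum_mem _ fun t ht => ?_
    have h1 := h t (mem_support_iff.1 ht)
    have h2 := hdeg t (mem_support_iff.1 ht)
    rw [Finsupp.degree_eq_sum, ← Finset.add_sum_erase _ _ (Finset.mem_univ i)] at h2
    rw [monomial_eq, Finsupp.prod_fintype _ _ (by simp),
      ← Finset.mul_prod_erase _ _ (Finset.mem_univ i), ← mul_assoc]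
    refine Ideal.mul_mem_left _ _ ?_
    -- Each monomial contains at least ν factors X_j with j ≠ i, and all of these vanish at the
    -- `i`-th coordinate point.
    have h3 : ν.toNat ≤ ∑ j ∈ Finset.univ.erase i, t j := by omega
    refine Ideal.pow_le_pow_right h3 ?_
    rw [← Finset.prod_pow_eq_pow_sum]
    refine Ideal.prod_mem_prod fun j hj => Ideal.pow_mem_pow ?_ _
    rw [RingHom.mem_ker]
    simp [(Finset.mem_erase.1 hj).1]

/-! ### The reflections of the lattice in coordinates -/

theorem adj_le {n k j : ℕ} (hk : k < n) (hj : j ≤ n) : adj k j ≤ n := by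
  unfold adj; split_ifs <;> omega

theorem one_le_adj {k j : ℕ} (hk : 0 < k) (hj : 1 ≤ j) : 1 ≤ adj k j := by
  unfold adj; split_ifs <;> omega

theorem latRefl_apply (m n k : ℕ) (Λ : Lat n) :
    latRefl m n k Λ = Λ - pairing m n (h m n k) Λ • h m n k := rfl

/-- Pairing with h_k gives the difference of the coordinates k and k+1, so subtracting that multiple
of h_k swaps them. -/
theorem latRefl_of_pos {m n k : ℕ} (h0 : 0 < k) (hk : k < n) (Λ : Lat n) (j : ℕ) (hj : j ≤ n) :
    latRefl m n k Λ ⟨j, by omega⟩ = Λ ⟨adj k j, Nat.lt_succ_of_le (adj_le hk hj)⟩ := by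
  rw [latRefl_apply, pairing_h m n k hk, if_neg (by omega)]
  simp only [Pi.sub_apply, Pi.smul_apply, smul_eq_mul]
  rcases j with _ | j
  · have h1 : h m n k ⟨0, by omega⟩ = 0 := by
      have := h_apply_zero m n k
      rw [if_neg (by omega)] at this
      exact this
    have h2 : adj k 0 = 0 := adj_lt h0
    simp only [h1, h2, mul_zero, sub_zero]
  · rw [h_apply_mk, if_neg (by omega)]
    by_cases h1 : j + 1 = k
    · subst h1
      simp [adj_self]
    · by_cases h2 : j = k
      · subst h2
        simp [adj_succ]
      · have h3 : adj k (j + 1) = j + 1 := by unfold adj; split_ifs <;> omega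
        simp [h1, h2, h3]

/-- The index of `e_i` in the basis of the lattice, for a homogeneous coordinate `i`. -/
def latIdx {m n : ℕ} (hn : m < n) (i : Coord m) : Fin (n + 1) := ⟨i, by have := i.2.2; omega⟩

theorem pairing_h_zero {m n : ℕ} (hn : m < n) (Λ : Lat n) :
    pairing m n (h m n 0) Λ = -((m : ℤ) - 2) * Λ 0 - ∑ i : Coord m, Λ (latIdx hn i) := by
  rw [pairing_h m n 0 (by omega), if_pos rfl]
  congr 1
  symm
  refine Finset.sum_bij (fun (i : Coord m) _ => (⟨i - 1, by have := i.2; omega⟩ : Fin n)) ?_ ?_ ?_ ?_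
  · intro i _
    have := i.2
    simp only [Finset.mem_filter, Finset.mem_univ, true_and]
    omega
  · intro i _ j _ hij
    have h1 := i.2
    have h2 := j.2
    rw [Fin.mk.injEq] at hij
    exact Subtype.ext (by omega)
  · intro j hj
    rw [Finset.mem_filter] at hj
    exact ⟨⟨j + 1, by omega⟩, Finset.mem_univ _, by simp⟩
  · intro i _
    have := i.2
    congr 1
    rw [Fin.ext_iff]
    simp only [latIdx, Fin.val_succ]
    omega

/-- In terms of degree and multiplicities this is (m-1)d - ν₁ - ⋯ - ν_m, the degree of the Cremona
transform. -/
theorem latRefl_zero_zero {m n : ℕ} (hn : m < n) (Λ : Lat n) :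
    latRefl m n 0 Λ 0 = ((m : ℤ) - 1) * Λ 0 + ∑ i : Coord m, Λ (latIdx hn i) := by
  rw [latRefl_apply, pairing_h_zero hn, Pi.sub_apply, Pi.smul_apply, h_apply_zero, if_pos rfl,
    smul_eq_mul]
  ring

/-- Written with the new degree D, the first case says D - ν'_j = d - ν_j: the bound on the degree
in the `j`-th variable is preserved. This is the form in which the Cremona transform is checked. -/
theorem latRefl_zero_succ {m n : ℕ} (Λ : Lat n) (j : Fin n) :
    latRefl m n 0 Λ j.succ = if (j : ℕ) + 1 ≤ m then Λ 0 + Λ j.succ - latRefl m n 0 Λ 0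
      else Λ j.succ := by
  rw [latRefl_apply, Pi.sub_apply, Pi.smul_apply, h_apply_succ, if_pos rfl, Pi.sub_apply,
    Pi.smul_apply, h_apply_zero, if_pos rfl, smul_eq_mul, smul_eq_mul]
  split_ifs <;> ring

/-! ### Linear and Cremona transformations of the linear systems -/

theorem isHomogeneous_of_degree {σ R : Type*} [CommSemiring R] {f : MvPolynomial σ R} {d : ℕ}
    (h : ∀ t, f.coeff t ≠ 0 → t.degree = d) : f.IsHomogeneous d := fun t ht => by
  rw [← h t ht, Finsupp.degree_eq_weight_one]
  rfl

/-- The assumption `f ≠ 0` excludes a negative `Λ 0`, for which the system is zero and no natural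
degree exists. -/
theorem isHomogeneous_of_mem_L {m n : ℕ} {a : Coord m → KX m n} {Λ : Lat n}
    {f : MvPolynomial (Coord m) (KX m n)} (hf : f ∈ L a Λ) (h0 : f ≠ 0) :
    ∃ d : ℕ, Λ 0 = d ∧ f.IsHomogeneous d := by
  obtain ⟨t, ht⟩ := ne_zero_iff.1 h0
  refine ⟨t.degree, (hf.1 t ht).symm, isHomogeneous_of_degree fun s hs => ?_⟩
  have h1 := hf.1 t ht
  have h2 := hf.1 s hs
  omega

theorem eval₂_eval₂_C {σ τ K E : Type*} [CommSemiring K] [CommSemiring E] (θ : K →+* E) (y : τ → E)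
    (s : K →+* K) (B : σ → MvPolynomial τ K) (f : MvPolynomial σ K) :
    (f.eval₂ (C.comp s) B).eval₂ θ y = f.eval₂ (θ.comp s) fun i => (B i).eval₂ θ y := by
  have : (eval₂Hom θ y).comp (eval₂Hom (C.comp s) B) =
      eval₂Hom (θ.comp s) fun i => (B i).eval₂ θ y :=
    MvPolynomial.ringHom_ext (fun a => by simp) fun i => by simp
  exact RingHom.congr_fun this f

/-- Transport of a linear system along a semilinear coordinate change that permutes the points. -/
theorem exists_mem_L_of_linear {m n : ℕ} {a b : Coord m → KX m n} {Λ Λ' : Lat n}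
    (σ : KX m n →+* KX m n) (B : Coord m → MvPolynomial (Coord m) (KX m n))
    (hB : ∀ i, (B i).IsHomogeneous 1) (h0 : Λ' 0 = Λ 0)
    (h : ∀ j : Fin n, ∃ j' : Fin n, Λ' j.succ = Λ j'.succ ∧
      ∃ c ≠ 0, ∀ i, σ (pt a (j' + 1) i) = c * eval (pt b (j + 1)) (B i))
    {E : Type*} [Field E] (θ : KX m n →+* E) (y y' : Coord m → E) (r : E)
    (hy : ∀ i, y' i = r * (B i).eval₂ θ y)
    {f : MvPolynomial (Coord m) (KX m n)} (hf : f ∈ L a Λ) :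
    ∃ g ∈ L b Λ', f.eval₂ (θ.comp σ) y' = r ^ Λ 0 * g.eval₂ θ y := by
  rcases eq_or_ne f 0 with rfl | hf0
  · exact ⟨0, zero_mem _, by simp⟩
  obtain ⟨d, hd, hfd⟩ := isHomogeneous_of_mem_L hf hf0
  -- The transported form is the pullback along `B` of `f` with σ applied to its coefficients. The
  -- hypothesis `h` says that `B` takes each point p_j to a σ-conjugate of another point, up to
  -- scale.
  refine ⟨f.eval₂ (C.comp σ) B, ⟨fun t ht => ?_, fun j => ?_⟩, ?_⟩
  · have h1 : (f.eval₂ (C.comp σ) B).IsHomogeneous (1 * d) :=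
      hfd.eval₂ _ _ (fun c => isHomogeneous_C _ _) hB
    have h2 := h1.degree_eq_sum_deg_support (mem_support_iff.2 ht)
    rw [Finsupp.degree_apply, ← h2, h0, hd, one_mul]
  · obtain ⟨j', e1, c, hc, e2⟩ := h j
    rw [e1]
    exact (hf.2 j').map_smul hfd σ B _ c hc e2
  · rw [eval₂_eval₂_C, funext hy, eval₂_mul_of_isHomogeneous hfd, hd, zpow_natCast]

theorem pt_of_le {m n j : ℕ} (hj : 1 ≤ j) (hj' : j ≤ m) :
    pt (1 : Coord m → KX m n) j = Pi.single ⟨j, hj, hj'⟩ 1 := by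
  ext i
  simp [pt, hj', Pi.single_apply, Subtype.ext_iff]

theorem pt_of_lt {m n j : ℕ} (hj : m < j) (i : Coord m) :
    pt (1 : Coord m → KX m n) j i = u m n i j := by
  simp [pt, hj]

/-- The Cremona transform `X^b f(1/X)` of a polynomial, with `s` applied to the coefficients. -/
noncomputable def cremona {ι K : Type*} [CommSemiring K] (s : K →+* K) (b : ι →₀ ℕ)
    (f : MvPolynomial ι K) : MvPolynomial ι K :=
  ∑ t ∈ f.support, monomial (b - t) (s (f.coeff t))

/-- In the term of exponent t, the variable X_i occurs on the left with exponent b_i + (d - t_i),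
which is (b_i - t_i) + d. The identity replaces f(1/X) by a polynomial pullback, to which statements
on orders of vanishing apply. -/
theorem cremona_mul_prod {ι K : Type*} [CommSemiring K] [Fintype ι] [DecidableEq ι] (s : K →+* K)
    {b : ι →₀ ℕ} {f : MvPolynomial ι K} {d : ℕ} (hb : ∀ t ∈ f.support, ∀ i, t i ≤ b i)
    (hd : ∀ t ∈ f.support, ∑ i, t i = d) :
    (∏ i, X i ^ b i) * f.eval₂ (C.comp s) (fun i => ∏ l ∈ Finset.univ.erase i, X l) =
      (∏ i, X i) ^ d * cremona s b f := by
  rw [cremona, eval₂_eq', Finset.mul_sum, Finset.mul_sum]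
  refine Finset.sum_congr rfl fun t ht => ?_
  rw [monomial_eq, Finsupp.prod_fintype _ _ (by simp), ← hd t ht, ← Finset.prod_pow_eq_pow_sum,
    RingHom.comp_apply, mul_left_comm, mul_left_comm (∏ i, _ ^ t i) (C _),
    ← Finset.prod_mul_distrib, ← Finset.prod_mul_distrib]
  congr 1
  refine Finset.prod_congr rfl fun i _ => ?_
  rw [← Finset.mul_prod_erase _ _ (Finset.mem_univ i), Finsupp.tsub_apply, mul_pow]
  obtain ⟨c, hc⟩ := Nat.exists_eq_add_of_le (hb t ht i)
  rw [hc, add_tsub_cancel_left, pow_add]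
  ring

theorem eval₂_inv_eq_cremona {ι K E : Type*} [CommSemiring K] [Field E] [Fintype ι]
    (s : K →+* K) {b : ι →₀ ℕ} {f : MvPolynomial ι K} (hb : ∀ t ∈ f.support, ∀ i, t i ≤ b i)
    (θ : K →+* E) (y : ι → E) (hy : ∀ i, y i ≠ 0) :
    f.eval₂ (θ.comp s) (fun i => (y i)⁻¹) =
      (∏ i, y i ^ (-(b i : ℤ))) * (cremona s b f).eval₂ θ y := by
  rw [cremona, eval₂_eq', eval₂_sum, Finset.mul_sum]
  refine Finset.sum_congr rfl fun t ht => ?_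
  rw [eval₂_monomial, Finsupp.prod_fintype _ _ (by simp), mul_left_comm, RingHom.comp_apply,
    ← Finset.prod_mul_distrib]
  congr 1
  refine Finset.prod_congr rfl fun i _ => ?_
  obtain ⟨c, hc⟩ := Nat.exists_eq_add_of_le (hb t ht i)
  rw [zpow_neg, zpow_natCast, Finsupp.tsub_apply, hc, add_tsub_cancel_left, pow_add, inv_pow]
  have := hy i
  field_simp

/-- Transport of a linear system along the standard Cremona transformation. -/
theorem exists_mem_L_of_cremona {m n : ℕ} (hn : m < n) {Λ : Lat n} (σ : KX m n →+* KX m n)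
    (hσ : ∀ i j, InRange m n i j → σ (u m n i j) = (u m n i j)⁻¹)
    {E : Type*} [Field E] (θ : KX m n →+* E) (y : Coord m → E) (hy : ∀ i, y i ≠ 0)
    {f : MvPolynomial (Coord m) (KX m n)} (hf : f ∈ L 1 Λ) :
    ∃ g ∈ L 1 (latRefl m n 0 Λ), f.eval₂ (θ.comp σ) (fun i => (y i)⁻¹) =
      (∏ i, y i ^ (-(Λ 0 + Λ (latIdx hn i)))) * g.eval₂ θ y := by
  rcases eq_or_ne f 0 with rfl | hf0
  · exact ⟨0, zero_mem _, by simp⟩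
  obtain ⟨d, hd, hfd⟩ := isHomogeneous_of_mem_L hf hf0
  -- The multiplicity ν_i = -Λ_i at the `i`-th coordinate point bounds the degree in x_i by d - ν_i.
  have hle : ∀ t, f.coeff t ≠ 0 → ∀ i : Coord m, (t i : ℤ) ≤ d + Λ (latIdx hn i) := by
    intro t ht i
    have h1 := hf.2 ⟨i - 1, by have := i.2; omega⟩
    have h2 : (i : ℕ) - 1 + 1 = i := by have := i.2; omega
    have h3 : (⟨i - 1, by have := i.2; omega⟩ : Fin n).succ = latIdx hn i := by
      rw [Fin.ext_iff]; simp [latIdx, h2]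
    rw [h3] at h1
    simp only [h2] at h1
    rw [pt_of_le i.2.1 i.2.2] at h1
    have := (vanishesToOrder_single_iff hfd i _).1 h1 t ht
    omega
  -- Take b_i = d - ν_i. It is nonnegative because it bounds the exponents of a monomial that occurs
  -- in `f`.
  obtain ⟨b, hb⟩ : ∃ b : Coord m →₀ ℕ, ∀ i, (b i : ℤ) = d + Λ (latIdx hn i) := by
    obtain ⟨t, ht⟩ := ne_zero_iff.1 hf0
    refine ⟨Finsupp.equivFunOnFinite.symm fun i => (d + Λ (latIdx hn i)).toNat, fun i => ?_⟩
    have := hle t ht i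
    simp only [Finsupp.equivFunOnFinite_symm_apply_apply]
    omega
  have hle' : ∀ t ∈ f.support, ∀ i, t i ≤ b i := fun t ht i => by
    have h1 := hle t (mem_support_iff.1 ht) i
    have h2 := hb i
    omega
  have hdeg : ∀ t ∈ f.support, ∑ i, t i = d := fun t ht => by
    rw [← Finsupp.degree_eq_sum]; exact (hfd.degree_eq_sum_deg_support ht).symm
  set g := cremona σ b f with hg
  have hcoeff : ∀ s, g.coeff s ≠ 0 → ∃ t ∈ f.support, s = b - t := by
    intro s hs
    rw [hg, cremona, coeff_sum] at hs
    obtain ⟨t, ht, h1⟩ := Finset.exists_ne_zero_of_sum_ne_zero hs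
    refine ⟨t, ht, ?_⟩
    by_contra hne
    rw [coeff_monomial, if_neg (Ne.symm hne)] at h1
    exact h1 rfl
  have hdeg' : ∀ s, g.coeff s ≠ 0 → (s.degree : ℤ) = latRefl m n 0 Λ 0 := by
    intro s hs
    obtain ⟨t, ht, rfl⟩ := hcoeff s hs
    have h1 : ((b - t).degree : ℤ) = ∑ i, (b i : ℤ) - ∑ i, (t i : ℤ) := by
      rw [Finsupp.degree_eq_sum, Nat.cast_sum, ← Finset.sum_sub_distrib]
      refine Finset.sum_congr rfl fun i _ => ?_
      rw [Finsupp.tsub_apply, Nat.cast_sub (hle' t ht i)]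
    rw [h1, latRefl_zero_zero hn, hd, ← Nat.cast_sum (f := fun i => t i), hdeg t ht, Finset.sum_congr rfl fun i _ => hb i,
      Finset.sum_add_distrib, Finset.sum_const, Finset.card_univ]
    have h2 : Fintype.card (Coord m) = m := by
      rw [Fintype.card_of_subtype (Finset.Icc 1 m) (by simp)]
      simp
    rw [h2]
    simp
    ring
  have hid := cremona_mul_prod σ hle' hdeg
  refine ⟨g, ⟨hdeg', fun j => ?_⟩, ?_⟩
  · rcases eq_or_ne g 0 with h0 | h0
    · rw [h0]; exact (L (1 : Coord m → KX m n) (latRefl m n 0 Λ)).zero_mem.2 j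
    rw [latRefl_zero_succ]
    split_ifs with hj
    -- At a coordinate point the condition is again an exponent bound: b_i - t_i ≤ b_i = D - ν'_i.
    · obtain ⟨D, hD⟩ : ∃ D : ℕ, latRefl m n 0 Λ 0 = D := by
        obtain ⟨t, ht⟩ := ne_zero_iff.1 h0
        exact ⟨_, (hdeg' t ht).symm⟩
      have hgD : g.IsHomogeneous D := isHomogeneous_of_degree fun s hs => by
        have := hdeg' s hs
        omega
      rw [pt_of_le (by omega) hj, vanishesToOrder_single_iff hgD]
      intro s hs
      obtain ⟨t, ht, rfl⟩ := hcoeff s hs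
      have h1 := hb ⟨j + 1, by omega, hj⟩
      have h2 : latIdx hn ⟨j + 1, by omega, hj⟩ = j.succ := rfl
      rw [h2] at h1
      have h3 := Nat.sub_le (b ⟨j + 1, by omega, hj⟩) (t ⟨j + 1, by omega, hj⟩)
      rw [Finsupp.tsub_apply]
      omega
    -- The remaining points lie off the coordinate hyperplanes, so the power of the product of the
    -- variables in `hid` can be cancelled there.
    · have hX : ∀ i : Coord m, eval (pt (1 : Coord m → KX m n) (j + 1)) (X i) ≠ 0 := fun i => by
        rw [eval_X, pt_of_lt (by omega)]; exact u_ne_zero _ _ _ _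
      refine VanishesToOrder.of_mul (f := (∏ i, X i) ^ d) ?_ ?_
      · rw [← hid, vanishesToOrder_iff]
        refine Ideal.mul_mem_left _ _ ?_
        rw [← vanishesToOrder_iff]
        -- The product of all coordinates except the `i`-th, divided by the product of all of them,
        -- is 1/u_{i,j+1} = σ(u_{i,j+1}).
        refine (hf.2 j).map_smul hfd σ _ _ (∏ i : Coord m, u m n i (j + 1))⁻¹
          (inv_ne_zero (Finset.prod_ne_zero_iff.2 fun i _ => u_ne_zero _ _ _ _)) fun i => ?_
        rw [pt_of_lt (by omega), hσ _ _ ⟨i.2.1, i.2.2, by omega, by omega⟩, map_prod]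
        simp only [eval_X]
        rw [Finset.prod_congr rfl fun l _ => pt_of_lt (by omega) l,
          ← Finset.mul_prod_erase _ _ (Finset.mem_univ i), mul_inv, mul_assoc, inv_mul_cancel₀,
          mul_one]
        exact Finset.prod_ne_zero_iff.2 fun l _ => u_ne_zero _ _ _ _
      · rw [map_pow, map_prod]
        exact pow_ne_zero _ (Finset.prod_ne_zero_iff.2 fun i _ => hX i)
  · simp only [eval₂_inv_eq_cremona σ hle' θ y hy, hd, ← hb, hg]

/-! ### The Weyl group action and the inclusion of function fields -/

theorem inclK_algebraMap {m n : ℕ} (r : MvPolynomial (Idx m n) ℂ) :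
    inclK m n (algebraMap _ (KX m n) r) = algebraMap _ (KX m (n + 1)) (rename (fun p : Idx m n =>
      (⟨p.1, p.2.1, p.2.2.1, p.2.2.2.1, p.2.2.2.2.trans n.le_succ⟩ : Idx m (n + 1))) r) :=
  IsFractionRing.lift_algebraMap
    (g := ((IsScalarTower.toAlgHom ℂ (MvPolynomial (Idx m (n + 1)) ℂ) (KX m (n + 1))).comp
      (rename fun p : Idx m n =>
        (⟨p.1, p.2.1, p.2.2.1, p.2.2.2.1, p.2.2.2.2.trans n.le_succ⟩ : Idx m (n + 1)))).toRingHom)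
    ((IsFractionRing.injective (MvPolynomial (Idx m (n + 1)) ℂ) (KX m (n + 1))).comp
      (rename_injective _ fun _ _ hpq => Subtype.ext (Subtype.mk.inj hpq))) r

theorem inclK_u {m n i j : ℕ} (hj : j ≤ n) : inclK m n (u m n i j) = u m (n + 1) i j := by
  by_cases h : 1 ≤ i ∧ i + 1 ≤ m ∧ m + 2 ≤ j ∧ j ≤ n
  · have h' : 1 ≤ i ∧ i + 1 ≤ m ∧ m + 2 ≤ j ∧ j ≤ n + 1 := by omega
    have h1 := X_eq_u (m := m) (n := n) ⟨(i, j), h⟩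
    have h2 := X_eq_u (m := m) (n := n + 1) ⟨(i, j), h'⟩
    dsimp only at h1 h2
    rw [← h1, ← h2, inclK_algebraMap, rename_X]
  · have h' : ¬ (1 ≤ i ∧ i + 1 ≤ m ∧ m + 2 ≤ j ∧ j ≤ n + 1) := by omega
    rw [u, u, dif_neg h, dif_neg h', map_one]

theorem algHom_eq_of_u {m n : ℕ} {E : Type*} [Field E] [Algebra ℂ E] {φ ψ : KX m n →ₐ[ℂ] E}
    (h : ∀ i j, 1 ≤ i ∧ i + 1 ≤ m ∧ m + 2 ≤ j ∧ j ≤ n → φ (u m n i j) = ψ (u m n i j)) :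
    φ = ψ := by
  refine IsLocalization.algHom_ext (nonZeroDivisors (MvPolynomial (Idx m n) ℂ)) ?_
  refine MvPolynomial.algHom_ext fun p => ?_
  have := h p.1.1 p.1.2 p.2
  rw [← X_eq_u] at this
  exact this

/-- For k < n the table sends columns up to n to expressions in columns up to n, so s_k is
compatible with forgetting the last point. -/
theorem sub_inclK {m n k : ℕ} (hm : 1 < m) (hk : k < n) (x : KX m n) :
    sub m (n + 1) k hm (hk.trans n.lt_succ_self) (inclK m n x) = inclK m n (sub m n k hm hk x) := by
  have hk' : k < n + 1 := by omega
  have : (sub m (n + 1) k hm hk').comp (inclK m n) = (inclK m n).comp (sub m n k hm hk) := by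
    refine algHom_eq_of_u fun i j hij => ?_
    have h1 : InRange m n i j := by unfold InRange; omega
    have h2 : InRange m (n + 1) i j := by unfold InRange; omega
    rw [AlgHom.comp_apply, AlgHom.comp_apply, inclK_u hij.2.2.2, sub_u' hm hk' i j h2,
      sub_u' hm hk i j h1]
    refine Eq.trans ?_ (map_tab (inclK m n : KX m n →+* KX m (n + 1)) m k (u m n) i j).symm
    have h3 : ∀ i j, InRange m n i j → u m (n + 1) i j = inclK m n (u m n i j) :=
      fun i j h => (inclK_u h.2.2.2).symm
    exact tab_congr hm hk h3 i j h1
  exact DFunLike.congr_fun this x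

theorem fieldAct_s_eq_sub {m n : ℕ} (hm : 1 < m) (k : Fin n) :
    fieldAct m n hm (s m n k) = sub m n k hm k.2 :=
  (coxeterMatrix m n).toCoxeterSystem.lift_apply_simple (f := fun k : Fin n => sub m n k hm k.2) _ k

theorem inclW_s {m n : ℕ} (k : Fin n) : inclW m n (s m n k) = s m (n + 1) k.castSucc :=
  (coxeterMatrix m n).toCoxeterSystem.lift_apply_simple
    (f := fun k : Fin n => s m (n + 1) k.castSucc) _ k

theorem latAct_s {m n : ℕ} (hn : m < n) (k : Fin n) : latAct m n hn (s m n k) = latRefl m n k :=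
  (coxeterMatrix m n).toCoxeterSystem.lift_apply_simple (f := fun k : Fin n => latRefl m n k) _ k

theorem sub_sub {m n k : ℕ} (hm : 1 < m) (hk : k < n) (x : KX m n) :
    sub m n k hm hk (sub m n k hm hk x) = x := by
  have h := fieldAct_s_eq_sub hm (⟨k, hk⟩ : Fin n)
  have h2 : s m n ⟨k, hk⟩ * s m n ⟨k, hk⟩ = 1 :=
    (coxeterMatrix m n).toCoxeterSystem.simple_mul_simple_self _
  have h3 : fieldAct m n hm (s m n ⟨k, hk⟩) * fieldAct m n hm (s m n ⟨k, hk⟩) = 1 := by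
    rw [← map_mul, h2, map_one]
  rw [h] at h3
  exact DFunLike.congr_fun h3 x

theorem latRefl_latRefl {m n k : ℕ} (hn : m < n) (hk : k < n) (Λ : Lat n) :
    latRefl m n k (latRefl m n k Λ) = Λ := by
  have h := latAct_s hn (⟨k, hk⟩ : Fin n)
  have h2 : s m n ⟨k, hk⟩ * s m n ⟨k, hk⟩ = 1 :=
    (coxeterMatrix m n).toCoxeterSystem.simple_mul_simple_self _
  have h3 : latAct m n hn (s m n ⟨k, hk⟩) * latAct m n hn (s m n ⟨k, hk⟩) = 1 := by
    rw [← map_mul, h2, map_one]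
  rw [h] at h3
  exact DFunLike.congr_fun h3 Λ

/-! ### Evaluation at the general point -/

/-- The general point is not a zero of a nonzero form. -/
theorem eval₂_z_ne_zero {m n : ℕ} (hm : 1 < m) (hn : m < n)
    {f : MvPolynomial (Coord m) (KX m n)} {d : ℕ} (hf : f.IsHomogeneous d) (h0 : f ≠ 0) :
    f.eval₂ (inclK m n : KX m n →+* KX m (n + 1)) (fun i : Coord m => z m n i) ≠ 0 := by
  classical
  -- A common denominator of the coefficients reduces the claim to a form with polynomial
  -- coefficients.
  obtain ⟨b, hb⟩ := IsLocalization.exist_integer_multiples_of_finset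
    (nonZeroDivisors (MvPolynomial (Idx m n) ℂ)) (f.support.image fun t => f.coeff t)
  set α := algebraMap (MvPolynomial (Idx m n) ℂ) (KX m n) with hα
  have hb0 : α b ≠ 0 :=
    (map_ne_zero_iff _ (IsFractionRing.injective _ _)).2 (nonZeroDivisors.ne_zero b.2)
  obtain ⟨g, hg⟩ : ∃ g, map α g = C (α b) * f := by
    have : C (α b) * f ∈ Set.range (map α) := by
      rw [mem_range_map_iff_coeffs_subset]
      intro c hc
      obtain ⟨t, ht, rfl⟩ := mem_coeffs_iff.1 hc
      rw [coeff_C_mul]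
      by_cases h : f.coeff t = 0
      · rw [h, mul_zero]; exact ⟨0, map_zero _⟩
      · obtain ⟨r, hr⟩ := hb _ (Finset.mem_image_of_mem _ (mem_support_iff.2 h))
        exact ⟨r, by rw [hr]; exact Algebra.smul_def _ _⟩
    exact this
  have hgd : g.IsHomogeneous d := by
    refine IsHomogeneous.of_map (f := α) (IsFractionRing.injective _ _) ?_
    rw [hg]; exact hf.C_mul _
  have hg0 : g ≠ 0 := by
    rintro rfl
    rw [map_zero] at hg
    exact mul_ne_zero (by simpa using hb0) h0 hg.symm
  set β := algebraMap (MvPolynomial (Idx m (n + 1)) ℂ) (KX m (n + 1)) with hβ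
  set ι : MvPolynomial (Idx m n) ℂ →ₐ[ℂ] MvPolynomial (Idx m (n + 1)) ℂ :=
    rename fun p : Idx m n =>
      (⟨p.1, p.2.1, p.2.2.1, p.2.2.2.1, p.2.2.2.2.trans n.le_succ⟩ : Idx m (n + 1)) with hι
  let Z : Coord m → MvPolynomial (Idx m (n + 1)) ℂ := fun i =>
    if h : (i : ℕ) + 1 ≤ m then X ⟨(i, n + 1), i.2.1, h, by omega, le_rfl⟩ else 1
  have hZ : ∀ i, β (Z i) = z m n i := by
    intro i
    unfold Z
    split_ifs with h
    · exact X_eq_u _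
    · have h1 : (i : ℕ) = m := by have := i.2; omega
      rw [z, u_eq_one (Or.inl h1), map_one]
  have hαβ : ∀ r, inclK m n (α r) = β (ι r) := inclK_algebraMap
  have key : g.eval₂ ι.toRingHom Z ≠ 0 := by
    -- `ψ` regards the last column as variables over the polynomial ring in the other columns. Under
    -- it, evaluation at the general point becomes dehomogenization at X_m = 1, which kills no
    -- nonzero form.
    let ψ : MvPolynomial (Idx m (n + 1)) ℂ →+* MvPolynomial (Coord m) (MvPolynomial (Idx m n) ℂ) :=
      eval₂Hom (C.comp C) fun p => if h : p.1.2 ≤ n then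
        C (X ⟨p.1, p.2.1, p.2.2.1, p.2.2.2.1, h⟩) else X ⟨p.1.1, p.2.1, by have := p.2; omega⟩
    have h1 : ψ.comp (eval₂Hom ι.toRingHom Z) = eval₂Hom C (Function.update X ⟨m, hm.le, le_rfl⟩ 1) := by
      refine MvPolynomial.ringHom_ext (fun r => ?_) fun i => ?_
      · have : (ψ.comp ι.toRingHom) = C := by
          refine MvPolynomial.ringHom_ext (fun c => ?_) fun p => ?_
          · simp [ψ, ι]
          · have := p.2.2.2.2
            simp [ψ, ι, this]
        have := RingHom.congr_fun this r
        simpa using this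
      · rw [RingHom.comp_apply, eval₂Hom_X', eval₂Hom_X']
        unfold Z
        split_ifs with h
        · have hne : i ≠ ⟨m, hm.le, le_rfl⟩ := by rintro rfl; simp at h
          rw [Function.update_of_ne hne]
          simp [ψ]
        · have he : i = ⟨m, hm.le, le_rfl⟩ := Subtype.ext (by have := i.2; simp only; omega)
          rw [he, Function.update_self, map_one]
    intro h
    refine dehomogenize_ne_zero hgd hg0 ⟨m, hm.le, le_rfl⟩ ?_
    have := RingHom.congr_fun h1 g
    rw [RingHom.comp_apply, coe_eval₂Hom ι.toRingHom, h, map_zero] at this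
    exact this.symm
  intro h
  apply key
  apply IsFractionRing.injective (MvPolynomial (Idx m (n + 1)) ℂ) (KX m (n + 1))
  rw [map_zero]
  have h1 : (map α g).eval₂ (inclK m n : KX m n →+* KX m (n + 1)) (fun i : Coord m => z m n i) = 0 := by
    rw [hg, eval₂_mul, h, mul_zero]
  rw [eval₂_map] at h1
  rw [← h1, ← hβ, eval₂_comp_left]
  congr 1
  · exact RingHom.ext fun r => (hαβ r).symm
  · exact funext hZ

/-- The value of a polynomial in the coordinates `x` at the general point
`(a₁x₁ : ⋯ : a_mx_m) = (z₁ : ⋯ : z_{m-1} : 1)`. -/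
noncomputable def genVal {m n : ℕ} (a : Coord m → KX m n) (f : MvPolynomial (Coord m) (KX m n)) :
    KX m (n + 1) :=
  f.eval₂ (inclK m n : KX m n →+* KX m (n + 1)) fun i : Coord m => z m n i / inclK m n (a i)

theorem z_ne_zero (m n i : ℕ) : z m n i ≠ 0 := u_ne_zero _ _ _ _

/-- Rescaling the variables by b_i / a_i fixes every point and the general point. Transport
therefore need only be proved for `a = 1`. -/
theorem exists_mem_L_genVal_eq {m n : ℕ} {a b : Coord m → KX m n}
    (hb : ∀ i, b i ≠ 0) {Λ : Lat n} {f : MvPolynomial (Coord m) (KX m n)} (hf : f ∈ L a Λ) :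
    ∃ g ∈ L b Λ, genVal a f = genVal b g := by
  have key := exists_mem_L_of_linear (b := b) (Λ' := Λ) (RingHom.id _)
    (fun i => C (b i / a i) * X i) (fun i => isHomogeneous_C_mul_X _ _) rfl
    (fun j => ⟨j, rfl, 1, one_ne_zero, fun i => by
      have := hb i
      simp only [RingHom.id_apply, pt, map_mul, eval_C, eval_X]
      field_simp⟩)
    (inclK m n : KX m n →+* KX m (n + 1)) (fun i : Coord m => z m n i / inclK m n (b i))
    (fun i : Coord m => z m n i / inclK m n (a i)) 1 (fun i => by
      have : inclK m n (b i) ≠ 0 := by simpa using hb i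
      simp only [eval₂_mul, eval₂_C, eval₂_X, RingHom.coe_coe, map_div₀]
      field_simp) hf
  obtain ⟨g, hg, h⟩ := key
  exact ⟨g, hg, by simpa [genVal] using h⟩

/-! ### Transport of linear systems by the simple reflections. -/

theorem sub_genVal_one {m n k : ℕ} (hm : 1 < m) (hk : k < n) (f : MvPolynomial (Coord m) (KX m n)) :
    sub m (n + 1) k hm (hk.trans n.lt_succ_self) (genVal 1 f) =
      f.eval₂ ((inclK m n : KX m n →+* KX m (n + 1)).comp (sub m n k hm hk : KX m n →+* KX m n))
        fun i : Coord m => sub m (n + 1) k hm (hk.trans n.lt_succ_self) (z m n i) := by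
  rw [genVal]
  refine (eval₂_comp_left (sub m (n + 1) k hm (hk.trans n.lt_succ_self) :
    KX m (n + 1) →+* KX m (n + 1)) _ _ f).trans ?_
  congr 1
  · exact RingHom.ext fun x => sub_inclK hm hk x
  · funext i; simp

theorem sub_z {m n k : ℕ} (hm : 1 < m) (hn : m < n) (hk : k < n + 1) (i : Coord m) :
    sub m (n + 1) k hm hk (z m n i) = table' m k (u m (n + 1)) i (n + 1) :=
  sub_u' hm hk _ _ ⟨i.2.1, i.2.2, by omega, le_rfl⟩

theorem genVal_one {m n : ℕ} (f : MvPolynomial (Coord m) (KX m n)) :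
    genVal 1 f = f.eval₂ (inclK m n : KX m n →+* KX m (n + 1)) fun i : Coord m => z m n i := by
  simp [genVal]

/-- As s₀(z_i) = 1/z_i, the image of the value of `f` is its conjugate evaluated at 1/z. Clearing
denominators to the exponents d - ν_i produces the displayed factor and the Cremona transform. -/
theorem exists_transport_zero {m n : ℕ} (hm : 1 < m) (hn : m < n) (Λ : Lat n)
    {f : MvPolynomial (Coord m) (KX m n)} (hf : f ∈ L 1 Λ) :
    ∃ g ∈ L 1 (latRefl m n 0 Λ), sub m (n + 1) 0 hm (by omega) (genVal 1 f) =
      (∏ i : Coord m, z m n i ^ (-(Λ 0 + Λ (latIdx hn i)))) * genVal 1 g := by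
  have h0 : 0 < n := by omega
  obtain ⟨g, hg, h⟩ := exists_mem_L_of_cremona hn (sub m n 0 hm h0 : KX m n →+* KX m n)
    (fun i j hij => (sub_u' hm h0 i j hij).trans (tab_zero _ _ _ _))
    (inclK m n : KX m n →+* KX m (n + 1)) (fun i : Coord m => z m n i) (fun i => z_ne_zero _ _ _) hf
  refine ⟨g, hg, ?_⟩
  rw [sub_genVal_one hm h0, genVal_one, ← h]
  congr 1
  funext i
  rw [sub_z hm hn, tab_zero]
  rfl

/-- Here `B` is the linear map inducing s_k. Its two hypotheses say that it permutes the n points as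
s_k does, up to conjugation and scale, and that it moves the general point in the same way, with
scale `r`. -/
theorem exists_transport_linear {m n k : ℕ} (hm : 1 < m) (h0 : 0 < k) (hk : k < n)
    (B : Coord m → MvPolynomial (Coord m) (KX m n)) (hB : ∀ i, (B i).IsHomogeneous 1)
    (h : ∀ j, 1 ≤ j → j ≤ n → ∃ c ≠ 0, ∀ i, sub m n k hm hk (pt 1 (adj k j) i) =
      c * eval (pt 1 j) (B i)) (r : KX m (n + 1))
    (hy : ∀ i : Coord m, sub m (n + 1) k hm (by omega) (z m n i) =
      r * (B i).eval₂ (inclK m n : KX m n →+* KX m (n + 1)) fun i : Coord m => z m n i) (Λ : Lat n)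
    {f : MvPolynomial (Coord m) (KX m n)} (hf : f ∈ L 1 Λ) :
    ∃ g ∈ L 1 (latRefl m n k Λ), sub m (n + 1) k hm (by omega) (genVal 1 f) =
      r ^ Λ 0 * genVal 1 g := by
  obtain ⟨g, hg, h⟩ := exists_mem_L_of_linear (Λ' := latRefl m n k Λ)
    (sub m n k hm hk : KX m n →+* KX m n) B hB
    ((latRefl_of_pos h0 hk Λ 0 n.zero_le).trans (by
      have : adj k 0 = 0 := adj_lt h0
      simp only [this]; rfl))
    (fun j => by
      have h1 := one_le_adj h0 (Nat.succ_le_succ (Nat.zero_le (j : ℕ)))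
      have h2 := adj_le hk j.2
      rw [Nat.succ_eq_add_one] at h1 h2
      have h3 : adj k (j + 1) - 1 + 1 = adj k (j + 1) := by omega
      obtain ⟨c, hc, h4⟩ := h (j + 1) (by omega) j.2
      refine ⟨⟨adj k (j + 1) - 1, by omega⟩, ?_, c, hc, ?_⟩
      · refine (latRefl_of_pos h0 hk Λ (j + 1) j.2).trans (congrArg Λ ?_)
        rw [Fin.ext_iff]
        exact h3.symm
      · simp only [h3]
        exact h4)
    (inclK m n : KX m n →+* KX m (n + 1)) (fun i : Coord m => z m n i) _ r hy hf
  refine ⟨g, hg, ?_⟩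
  rw [sub_genVal_one hm hk, genVal_one, ← h]

theorem pt_one_of_le {m n j : ℕ} (hj : j ≤ m) (i : Coord m) :
    pt (1 : Coord m → KX m n) j i = if (i : ℕ) = j then 1 else 0 := by
  simp [pt, hj]

/-- The linear maps are: a transposition of variables for k < m; x_i ↦ x_m - x_i (i < m) with x_m
fixed for k = m, which exchanges p_m and p_{m+1}; and a diagonal scaling for k > m, nontrivial only
for k = m+1. The scalar `r` restores the last coordinate of the general point to 1, so it differs
from 1 only for k = m-1. -/
theorem exists_transport_pos {m n k : ℕ} (hm : 1 < m) (hn : m < n) (h0 : 0 < k) (hk : k < n) :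
    ∃ r : KX m (n + 1), r ≠ 0 ∧ ∀ (Λ : Lat n) (f : MvPolynomial (Coord m) (KX m n)), f ∈ L 1 Λ →
      ∃ g ∈ L 1 (latRefl m n k Λ), sub m (n + 1) k hm (by omega) (genVal 1 f) =
        r ^ Λ 0 * genVal 1 g := by
  rcases node_cases (m := m) k with h | ⟨-, h⟩ | rfl | h
  · omega
  · have hadj : ∀ i : Coord m, adj k i ≤ m := fun i => adj_le h i.2.2
    refine ⟨(u m (n + 1) (adj k m) (n + 1))⁻¹, inv_ne_zero (u_ne_zero _ _ _ _), fun Λ f hf =>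
      exists_transport_linear hm h0 hk (fun i : Coord m => X ⟨adj k i, one_le_adj h0 i.2.1, hadj i⟩)
        (fun i => isHomogeneous_X _ _) (fun j hj hj' => ?_) _ (fun i => ?_) Λ hf⟩
    · rcases le_or_gt j m with hjm | hjm
      · refine ⟨1, one_ne_zero, fun i => ?_⟩
        rw [pt_one_of_le (adj_le h hjm), eval_X, pt_one_of_le hjm, one_mul]
        have : (i : ℕ) = adj k j ↔ adj k i = j :=
          ⟨fun e => by rw [e, adj_adj], fun e => by rw [← e, adj_adj]⟩
        simp only [this]
        split_ifs <;> simp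
      · refine ⟨(u m n (adj k m) j)⁻¹, inv_ne_zero (u_ne_zero _ _ _ _), fun i => ?_⟩
        rw [adj_gt (show k + 1 < j by omega), pt_of_lt hjm, eval_X, pt_of_lt hjm,
          sub_u' hm hk _ _ ⟨i.2.1, i.2.2, hjm, hj'⟩, tab_row h0 h, div_eq_inv_mul]
    · rw [sub_z hm hn, tab_row h0 h, eval₂_X, div_eq_inv_mul]
      rfl
  · refine ⟨1, one_ne_zero, fun Λ f hf =>
      exists_transport_linear hm h0 hk
        (fun i : Coord k => if (i : ℕ) = k then X i else X ⟨k, hm.le, le_rfl⟩ - X i)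
        (fun i => ?_) (fun j hj hj' => ?_) _ (fun i => ?_) Λ hf⟩
    · split_ifs
      · exact isHomogeneous_X _ _
      · exact (isHomogeneous_X _ _).sub (isHomogeneous_X _ _)
    · rcases lt_trichotomy j k with hjk | rfl | hjk
      -- The map x_i ↦ x_m - x_i negates the coordinate points other than p_m, hence the scalar -1.
      · refine ⟨-1, by simp, fun i => ?_⟩
        rw [adj_lt hjk, pt_one_of_le hjk.le]
        split_ifs with h1 h2 h2
        · omega
        · simp [pt_one_of_le hjk.le, h1, hjk.ne']
        · simp [pt_one_of_le hjk.le, h1]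
        · simp [pt_one_of_le hjk.le, h1, hjk.ne']
      · refine ⟨1, one_ne_zero, fun i => ?_⟩
        rw [adj_self, pt_of_lt (Nat.lt_succ_self _), u_eq_one (Or.inr rfl)]
        split_ifs with h1
        · simp [pt_one_of_le le_rfl, h1]
        · simp [pt_one_of_le le_rfl, h1]
      · rcases eq_or_ne j (k + 1) with rfl | hne
        · refine ⟨1, one_ne_zero, fun i => ?_⟩
          rw [adj_succ, pt_one_of_le le_rfl]
          split_ifs with h1
          · simp [pt_of_lt hjk, u_eq_one]
          · simp [pt_of_lt hjk, u_eq_one]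
        · refine ⟨1, one_ne_zero, fun i => ?_⟩
          rw [adj_gt (by omega), pt_of_lt hjk, sub_u' hm hk _ _ ⟨i.2.1, i.2.2, hjk, hj'⟩, tab_mid hm]
          by_cases h1 : (i : ℕ) = k
          · simp [h1, pt_of_lt hjk, u_eq_one]
          · simp [h1, hne, pt_of_lt hjk, u_eq_one]
    · rw [sub_z hm hn, tab_mid hm]
      by_cases h1 : (i : ℕ) = k
      · simp [h1, z, u_eq_one]
      · have : n ≠ k := by omega
        simp [h1, z, u_eq_one, this]
  · refine ⟨1, one_ne_zero, fun Λ f hf =>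
      exists_transport_linear hm h0 hk (fun i : Coord m => C (u m n i (adj k (m + 1)))⁻¹ * X i)
        (fun i => isHomogeneous_C_mul_X _ _) (fun j hj hj' => ?_) _ (fun i => ?_) Λ hf⟩
    · rcases le_or_gt j m with hjm | hjm
      -- The diagonal scaling fixes the `j`-th coordinate point only up to its `j`-th entry, which
      -- this scalar undoes.
      · refine ⟨u m n j (adj k (m + 1)), u_ne_zero _ _ _ _, fun i => ?_⟩
        rw [adj_lt (by omega), pt_one_of_le hjm, map_mul, eval_C, eval_X, pt_one_of_le hjm]
        split_ifs with h1
        · rw [h1, map_one, mul_one, mul_inv_cancel₀ (u_ne_zero _ _ _ _)]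
        · simp
      · refine ⟨1, one_ne_zero, fun i => ?_⟩
        have h1 : InRange m n i (adj k j) :=
          inRange_col (⟨i.2.1, i.2.2, hjm, hj'⟩ : InRange m n i j) h hk
        rw [pt_of_lt (Nat.lt_of_succ_le h1.2.2.1), sub_u' hm hk _ _ h1, tab_col h, adj_adj, map_mul,
          eval_C, eval_X, pt_of_lt hjm, one_mul, div_eq_inv_mul]
    · rw [sub_z hm hn, tab_col h, adj_gt (by omega), eval₂_mul, eval₂_C, eval₂_X, RingHom.coe_coe,
        map_inv₀, inclK_u (adj_le hk hn), one_mul, div_eq_inv_mul]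
      rfl

/-- The action of a simple reflection on the values of forms at the general point transports
`L(Λ)` to `L(s_k.Λ)`, up to a factor that is multiplicative in `Λ`. -/
theorem exists_transport {m n : ℕ} (hm : 1 < m) (hn : m < n) {a : Coord m → KX m n}
    (ha : ∀ i, a i ≠ 0) {k : ℕ} (hk : k < n) :
    ∃ ρ : Lat n → KX m (n + 1), (∀ Λ, ρ Λ ≠ 0) ∧ (∀ Λ Λ', ρ (Λ + Λ') = ρ Λ * ρ Λ') ∧
      ∀ Λ, ∀ f ∈ L a Λ, ∃ g ∈ L a (latRefl m n k Λ),
        sub m (n + 1) k hm (hk.trans n.lt_succ_self) (genVal a f) = ρ Λ * genVal a g := by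
  have red : ∀ ρ : Lat n → KX m (n + 1), (∀ Λ, ∀ f ∈ L 1 Λ, ∃ g ∈ L 1 (latRefl m n k Λ),
      sub m (n + 1) k hm (hk.trans n.lt_succ_self) (genVal 1 f) = ρ Λ * genVal 1 g) →
      ∀ Λ, ∀ f ∈ L a Λ, ∃ g ∈ L a (latRefl m n k Λ),
        sub m (n + 1) k hm (hk.trans n.lt_succ_self) (genVal a f) = ρ Λ * genVal a g := by
    intro ρ h Λ f hf
    obtain ⟨f', hf', e1⟩ := exists_mem_L_genVal_eq (b := 1) (fun _ => one_ne_zero) hf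
    obtain ⟨g', hg', e2⟩ := h Λ f' hf'
    obtain ⟨g, hg, e3⟩ := exists_mem_L_genVal_eq ha hg'
    exact ⟨g, hg, by rw [e1, e2, e3]⟩
  rcases Nat.eq_zero_or_pos k with rfl | h0
  · refine ⟨fun Λ => ∏ i : Coord m, z m n i ^ (-(Λ 0 + Λ (latIdx hn i))), fun Λ => ?_,
      fun Λ Λ' => ?_, red _ fun Λ f hf => exists_transport_zero hm hn Λ hf⟩
    · exact Finset.prod_ne_zero_iff.2 fun i _ => zpow_ne_zero _ (z_ne_zero _ _ _)
    · rw [← Finset.prod_mul_distrib]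
      refine Finset.prod_congr rfl fun i _ => ?_
      rw [← zpow_add₀ (z_ne_zero _ _ _)]
      congr 1
      simp only [Pi.add_apply]
      ring
  · obtain ⟨r, hr, h⟩ := exists_transport_pos hm hn h0 hk
    exact ⟨fun Λ => r ^ Λ 0, fun Λ => zpow_ne_zero _ hr, fun Λ Λ' => zpow_add₀ hr _ _, red _ h⟩

theorem genVal_smul {m n : ℕ} (a : Coord m → KX m n) (c : KX m n)
    (f : MvPolynomial (Coord m) (KX m n)) :
    genVal a (c • f) = inclK m n c * genVal a f := by
  rw [genVal, smul_eq_C_mul, eval₂_mul, eval₂_C]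
  rfl

theorem genVal_sub {m n : ℕ} (a : Coord m → KX m n) (f g : MvPolynomial (Coord m) (KX m n)) :
    genVal a (f - g) = genVal a f - genVal a g :=
  eval₂_sub _ _ _

/-- The substitution x_i ↦ x_i / a_i is invertible, so this reduces to the nonvanishing of a form at
(z₁ : ⋯ : z_{m-1} : 1). -/
theorem genVal_ne_zero {m n : ℕ} (hm : 1 < m) (hn : m < n) {a : Coord m → KX m n}
    (ha : ∀ i, a i ≠ 0) {Λ : Lat n} {f : MvPolynomial (Coord m) (KX m n)} (hf : f ∈ L a Λ)
    (h0 : f ≠ 0) : genVal a f ≠ 0 := by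
  obtain ⟨d, -, hd⟩ := isHomogeneous_of_mem_L hf h0
  set g : MvPolynomial (Coord m) (KX m n) :=
    f.eval₂ (C.comp (RingHom.id _)) fun i => C (a i)⁻¹ * X i with hg
  have h1 : g.IsHomogeneous (1 * d) :=
    hd.eval₂ _ _ (fun c => isHomogeneous_C _ _) fun i => isHomogeneous_C_mul_X _ _
  have h2 : g.eval₂ C (fun i => C (a i) * X i) = f := by
    rw [hg, eval₂_eval₂_C]
    have : (fun i : Coord m => eval₂ C (fun i => C (a i) * X i) (C (a i)⁻¹ * X i)) =
        (X : Coord m → MvPolynomial (Coord m) (KX m n)) := by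
      funext i
      rw [eval₂_mul, eval₂_C, eval₂_X, ← mul_assoc, ← C_mul, inv_mul_cancel₀ (ha i), C_1, one_mul]
    rw [this, RingHom.comp_id, eval₂_eta]
  have h3 : g ≠ 0 := by
    intro h
    rw [h, eval₂_zero] at h2
    exact h0 h2.symm
  have h4 : genVal a f = g.eval₂ (inclK m n : KX m n →+* KX m (n + 1)) fun i : Coord m => z m n i := by
    rw [hg, eval₂_eval₂_C, genVal, RingHom.comp_id]
    congr 1
    funext i
    rw [eval₂_mul, eval₂_C, eval₂_X, RingHom.coe_coe, map_inv₀, div_eq_inv_mul]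
  rw [h4]
  exact eval₂_z_ne_zero hm hn h1 h3

theorem genVal_injOn {m n : ℕ} (hm : 1 < m) (hn : m < n) {a : Coord m → KX m n}
    (ha : ∀ i, a i ≠ 0) {Λ : Lat n} {f g : MvPolynomial (Coord m) (KX m n)} (hf : f ∈ L a Λ)
    (hg : g ∈ L a Λ) (h : genVal a f = genVal a g) : f = g := by
  by_contra hne
  exact genVal_ne_zero hm hn ha (sub_mem hf hg) (sub_ne_zero.2 hne) (by rw [genVal_sub, h, sub_self])

/-! ### Dimension one -/

theorem e_apply_zero_of_coord {m n : ℕ} (i : Coord m) : e n i 0 = 0 := by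
  rw [e_apply_zero, if_neg (by have := i.2; omega)]

theorem one_mem_L_e {m n : ℕ} (a : Coord m → KX m n) {j : ℕ} (hj : 1 ≤ j) :
    (1 : MvPolynomial (Coord m) (KX m n)) ∈ L a (e n j) := by
  refine ⟨fun t ht => ?_, fun i => .of_nonpos _ _ ?_⟩
  · rw [coeff_one] at ht
    have : t = 0 := by
      by_contra h
      exact ht (if_neg (Ne.symm h))
    rw [this, e_apply_zero, if_neg (by omega)]
    simp
  · unfold e
    split_ifs <;> simp

/-- The vector e_j has degree 0 and prescribes only multiplicities ≤ 0, so the system consists of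
the constants. -/
theorem exists_basis_L_e {m n : ℕ} (a : Coord m → KX m n) {j : ℕ} (hj : 1 ≤ j) :
    ∃ f ∈ L a (e n j), f ≠ 0 ∧ ∀ g ∈ L a (e n j), ∃ c : KX m n, g = c • f := by
  refine ⟨1, one_mem_L_e a hj, one_ne_zero, fun g hg => ⟨g.coeff 0, ?_⟩⟩
  ext t
  rw [coeff_smul, coeff_one]
  split_ifs with h
  · simp [← h]
  · rw [smul_zero]
    by_contra hne
    have := hg.1 t hne
    rw [e_apply_zero, if_neg (by omega), Nat.cast_eq_zero, Finsupp.degree_eq_zero_iff] at this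
    exact h this.symm

/-- The transport of a generator is nonzero, and transporting any element back gives a multiple of
the old generator. Since s_k is an involution, the transport is itself a generator. -/
theorem exists_basis_L_latRefl {m n : ℕ} (hm : 1 < m) (hn : m < n) {a : Coord m → KX m n}
    (ha : ∀ i, a i ≠ 0) {k : ℕ} (hk : k < n) {Λ : Lat n}
    (h : ∃ f ∈ L a Λ, f ≠ 0 ∧ ∀ g ∈ L a Λ, ∃ c : KX m n, g = c • f) :
    ∃ f ∈ L a (latRefl m n k Λ), f ≠ 0 ∧ ∀ g ∈ L a (latRefl m n k Λ), ∃ c : KX m n, g = c • f := by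
  obtain ⟨ρ, hρ, -, tr⟩ := exists_transport hm hn ha hk
  obtain ⟨f, hf, hf0, hspan⟩ := h
  obtain ⟨g, hg, hfg⟩ := tr Λ f hf
  set S := sub m (n + 1) k hm (hk.trans n.lt_succ_self) with hS
  have hSS : ∀ x, S (S x) = x := sub_sub hm _
  -- The factor beside `c` is the same for every `p`. Comparing `p` with `g` cancels it, so the two
  -- values of ρ never have to be related.
  have back : ∀ p ∈ L a (latRefl m n k Λ), ∃ c : KX m n,
      genVal a p = S (ρ (latRefl m n k Λ)) * (S (inclK m n c) * S (genVal a f)) := by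
    intro p hp
    obtain ⟨q, hq, hpq⟩ := tr _ p hp
    rw [latRefl_latRefl hn hk] at hq
    obtain ⟨c, rfl⟩ := hspan q hq
    refine ⟨c, ?_⟩
    rw [← hSS (genVal a p), hpq, genVal_smul, map_mul, map_mul]
  have hg0 : g ≠ 0 := by
    rintro rfl
    have h1 : S (genVal a f) = 0 := by rw [hfg]; simp [genVal]
    exact genVal_ne_zero hm hn ha hf hf0 (by rw [← hSS (genVal a f), h1, map_zero])
  obtain ⟨c₀, hc₀⟩ := back g hg
  have hc₀' : c₀ ≠ 0 := by
    rintro rfl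
    refine genVal_ne_zero hm hn ha hg hg0 ?_
    rw [hc₀]; simp
  refine ⟨g, hg, hg0, fun p hp => ?_⟩
  obtain ⟨c, hc⟩ := back p hp
  -- The ratio of the two values is s_k(c / c₀). It lies in the smaller field because s_k preserves
  -- that field.
  refine ⟨sub m n k hm hk (c / c₀), genVal_injOn hm hn ha hp (Submodule.smul_mem _ _ hg) ?_⟩
  rw [genVal_smul, ← sub_inclK hm hk, hc, hc₀, map_div₀, ← hS, map_div₀]
  have : S (inclK m n c₀) ≠ 0 := by simpa using hc₀'
  field_simp

theorem exists_basis_L {m n : ℕ} (hm : 1 < m) (hn : m < n) {a : Coord m → KX m n}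
    (ha : ∀ i, a i ≠ 0) (w : W m n) {j : ℕ} (hj : 1 ≤ j) :
    ∃ f ∈ L a (latAct m n hn w (e n j)), f ≠ 0 ∧
      ∀ g ∈ L a (latAct m n hn w (e n j)), ∃ c : KX m n, g = c • f := by
  induction w using (coxeterMatrix m n).toCoxeterSystem.simple_induction_left with
  | one => rw [map_one]; exact exists_basis_L_e a hj
  | mul_simple_left w k ih =>
    have h1 : latAct m n hn ((coxeterMatrix m n).toCoxeterSystem.simple k * w) (e n j) =
        latRefl m n k (latAct m n hn w (e n j)) := by
      rw [map_mul]
      exact DFunLike.congr_fun (latAct_s hn k) _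
    rw [h1]
    exact exists_basis_L_latRefl hm hn ha k.2 ih

/-! ### The action on the general point -/

/-- Each of e₁, …, e_m pairs with h₀ to -1. That the difference is independent of `i` is what makes
the proportionality factor common to all coordinates. -/
theorem latRefl_zero_e {m n : ℕ} (hn : m < n) (i : Coord m) :
    latRefl m n 0 (e n i) = e n i + h m n 0 := by
  rw [latRefl_apply, pairing_h_zero hn, e_apply_zero_of_coord, Finset.sum_eq_single i]
  · simp [e, latIdx]
  · intro l _ hl
    have : (l : ℕ) ≠ i := fun h => hl (Subtype.ext h)
    simp [e, latIdx, this]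
  · simp

/-- Transporting the constant 1 in L(e_i) by s₀ leaves the value 1 on the left and the factor 1/z_i
on the right, so the new form has value z_i. -/
theorem exists_forms_one {m n : ℕ} (hm : 1 < m) (hn : m < n) {a : Coord m → KX m n}
    (ha : ∀ i, a i ≠ 0) (i : Coord m) :
    ∃ g ∈ L a (latRefl m n 0 (e n i)), genVal a g = z m n i := by
  obtain ⟨g, hg, h1⟩ := exists_transport_zero hm hn (e n i) (one_mem_L_e 1 i.2.1)
  obtain ⟨g', hg', h2⟩ := exists_mem_L_genVal_eq ha hg
  refine ⟨g', hg', ?_⟩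
  have h3 : ∏ l : Coord m, z m n l ^ (-(e n i 0 + e n i (latIdx hn l))) = (z m n i)⁻¹ := by
    rw [Finset.prod_eq_single i]
    · rw [e_apply_zero_of_coord]
      simp [e, latIdx]
    · intro l _ hl
      have : (l : ℕ) ≠ i := fun h => hl (Subtype.ext h)
      rw [e_apply_zero_of_coord]
      simp [e, latIdx, this]
    · simp
  have h4 : genVal (1 : Coord m → KX m n) 1 = 1 := eval₂_one _ _
  rw [h3, h4, map_one] at h1
  rw [← h2]
  have := z_ne_zero m n i
  field_simp at h1
  exact h1.symm

/-- The existence part of the description of the action on the general point. -/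
theorem exists_forms {m n : ℕ} (hm : 1 < m) (hn : m < n) {a : Coord m → KX m n}
    (ha : ∀ i, a i ≠ 0) (w : W m n) :
    ∃ F G : Coord m → MvPolynomial (Coord m) (KX m n),
      (∀ i : Coord m, F i ∈ L a (latAct m n hn w (e n i)) ∧ F i ≠ 0) ∧
      (∀ i : Coord m, G i ∈ L a (latAct m n hn w (latRefl m n 0 (e n i)))) ∧
      ∃ r : KX m (n + 1), r ≠ 0 ∧ ∀ i : Coord m,
        fieldAct m (n + 1) hm (inclW m n w) (z m n i) * genVal a (F i) = r * genVal a (G i) := by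
  induction w using (coxeterMatrix m n).toCoxeterSystem.simple_induction_left with
  | one =>
    choose G hG hG' using exists_forms_one hm hn ha
    refine ⟨fun _ => 1, G, fun i => ⟨?_, one_ne_zero⟩, fun i => ?_, 1, one_ne_zero, fun i => ?_⟩
    · rw [map_one]; exact one_mem_L_e a i.2.1
    · rw [map_one]; exact hG i
    · have : genVal a 1 = 1 := eval₂_one _ _
      rw [map_one, map_one, hG', this, mul_one, one_mul]
      rfl
  | mul_simple_left w k ih =>
    obtain ⟨F, G, hF, hG, r, hr, h⟩ := ih
    obtain ⟨ρ, hρ, hρ', tr⟩ := exists_transport hm hn ha k.2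
    choose F' hF' eF using fun i => tr _ (F i) (hF i).1
    choose G' hG' eG using fun i => tr _ (G i) (hG i)
    have act : ∀ Λ, latAct m n hn ((coxeterMatrix m n).toCoxeterSystem.simple k * w) Λ =
        latRefl m n k (latAct m n hn w Λ) := by
      intro Λ
      rw [map_mul]
      exact DFunLike.congr_fun (latAct_s hn k) _
    have fact : ∀ x, fieldAct m (n + 1) hm
        (inclW m n ((coxeterMatrix m n).toCoxeterSystem.simple k * w)) x =
        sub m (n + 1) k hm (k.2.trans n.lt_succ_self) (fieldAct m (n + 1) hm (inclW m n w) x) := by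
      intro x
      rw [map_mul, map_mul]
      refine DFunLike.congr_fun (?_ : fieldAct m (n + 1) hm (inclW m n (s m n k)) = _) _
      rw [inclW_s, fieldAct_s_eq_sub]
      rfl
    -- Multiplicativity gives ρ(w s₀.e_i) = ρ(w.e_i) ρ(w.h₀). After cancelling ρ(w.e_i), the new
    -- factor is s_k(r) ρ(w.h₀), independent of `i`.
    refine ⟨F', G', fun i => ⟨?_, ?_⟩, fun i => ?_,
      sub m (n + 1) k hm (k.2.trans n.lt_succ_self) r * ρ (latAct m n hn w (PointConfig.h m n 0)),
      mul_ne_zero (by simpa using hr) (hρ _), fun i => ?_⟩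
    · rw [act]; exact hF' i
    · intro h0
      have h1 := eF i
      rw [h0, show genVal a 0 = 0 from eval₂_zero _ _, mul_zero, map_eq_zero] at h1
      exact genVal_ne_zero hm hn ha (hF i).1 (hF i).2 h1
    · rw [act]; exact hG' i
    · have h1 := congrArg (sub m (n + 1) k hm (k.2.trans n.lt_succ_self)) (h i)
      rw [map_mul, map_mul, eF, eG, latRefl_zero_e hn, map_add, hρ'] at h1
      rw [fact]
      refine mul_left_cancel₀ (hρ (latAct m n hn w (e n i))) ?_
      linear_combination h1

/-- Any representative of the general point over an extension field is `t` times the standard one,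
so a form changes by `t` to its degree. -/
theorem eval₂_eq_genVal {m n : ℕ} {a : Coord m → KX m n} (ha : ∀ i, a i ≠ 0) {Λ : Lat n}
    {f : MvPolynomial (Coord m) (KX m n)} (hf : f ∈ L a Λ) {E : Type*} [Field E]
    [Algebra (KX m (n + 1)) E] {x : Coord m → E} {t : E}
    (hx : ∀ i, incl m n E (a i) * x i = t * algebraMap (KX m (n + 1)) E (z m n i)) :
    f.eval₂ (incl m n E) x = t ^ Λ 0 * algebraMap (KX m (n + 1)) E (genVal a f) := by
  rcases eq_or_ne f 0 with rfl | h0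
  · simp [genVal]
  obtain ⟨d, hd, hfd⟩ := isHomogeneous_of_mem_L hf h0
  have h1 : x = fun i : Coord m => t * algebraMap (KX m (n + 1)) E (z m n i / inclK m n (a i)) := by
    funext i
    have h2 : incl m n E (a i) ≠ 0 := by simpa using ha i
    have h3 : incl m n E (a i) = algebraMap (KX m (n + 1)) E (inclK m n (a i)) := rfl
    rw [map_div₀, ← h3, ← mul_div_assoc, ← hx, mul_div_cancel_left₀ _ h2]
  rw [h1, eval₂_mul_of_isHomogeneous hfd, hd, zpow_natCast, genVal, eval₂_comp_left]
  rfl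

end PointConfig

/-! ### Arbitrary generators and arbitrary representatives of the general point. -/

open PointConfig in
theorem mainTheorem4 (m n : ℕ) (hm : 1 < m) (hn : m < n)
    (a : PointConfig.Coord m → PointConfig.KX m n) (ha : ∀ i, a i ≠ 0) :
    (∀ Λ ∈ PointConfig.M m n hn,
      Module.finrank (PointConfig.KX m n) (PointConfig.L a Λ) = 1) ∧
    (∀ (w : PointConfig.W m n)
      (F G : PointConfig.Coord m →
        MvPolynomial (PointConfig.Coord m) (PointConfig.KX m n)),
      (∀ i : PointConfig.Coord m, F i ∈ PointConfig.L a (PointConfig.latAct m n hn w (PointConfig.e n i)) ∧ F i ≠ 0) →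
      (∀ i : PointConfig.Coord m, G i ∈ PointConfig.L a (PointConfig.latAct m n hn
        (w * PointConfig.s m n ⟨0, (Nat.zero_le m).trans_lt hn⟩) (PointConfig.e n i)) ∧ G i ≠ 0) →
      ∃ c : PointConfig.Coord m → PointConfig.KX m n, (∀ i, c i ≠ 0) ∧
        ∀ (E : Type*) [Field E] [Algebra (PointConfig.KX m (n + 1)) E]
          (x : PointConfig.Coord m → E),
          PointConfig.SamePoint
            (fun i => algebraMap (PointConfig.KX m (n + 1)) E (PointConfig.z m n i))
            (fun i => PointConfig.incl m n E (a i) * x i) →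
          (∀ i, (F i).eval₂ (PointConfig.incl m n E) x ≠ 0) ∧
          PointConfig.SamePoint
            (fun i => algebraMap (PointConfig.KX m (n + 1)) E
              (PointConfig.fieldAct m (n + 1) hm (PointConfig.inclW m n w) (PointConfig.z m n i)))
            (fun i => PointConfig.incl m n E (c i) *
              ((G i).eval₂ (PointConfig.incl m n E) x / (F i).eval₂ (PointConfig.incl m n E) x))) := by
  refine ⟨?_, fun w F G hF hG => ?_⟩
  · rintro Λ ⟨w, j, hj, -, rfl⟩
    obtain ⟨f, hf, hf0, h⟩ := exists_basis_L hm hn ha w hj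
    refine finrank_eq_one (⟨f, hf⟩ : L a (latAct m n hn w (e n j)))
      (fun h0 => hf0 (congrArg Subtype.val h0)) fun g => ?_
    obtain ⟨c, hc⟩ := h g.1 g.2
    exact ⟨c, Subtype.ext hc.symm⟩
  have hs : ∀ v, latAct m n hn (w * s m n ⟨0, (Nat.zero_le m).trans_lt hn⟩) v =
      latAct m n hn w (latRefl m n 0 v) := by
    intro v
    rw [map_mul, latAct_s]
    rfl
  obtain ⟨F₀, G₀, hF₀, hG₀, r, hr, hFG⟩ := exists_forms hm hn ha w
  have hF₀' : ∀ i, genVal a (F₀ i) ≠ 0 := fun i => genVal_ne_zero hm hn ha (hF₀ i).1 (hF₀ i).2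
  -- Both forms are nonzero elements of the same one-dimensional system.
  have hcF : ∀ i, ∃ c : KX m n, c ≠ 0 ∧ F i = c • F₀ i := by
    intro i
    obtain ⟨f, -, -, h⟩ := exists_basis_L hm hn ha w i.2.1
    obtain ⟨c, hc⟩ := h _ (hF i).1
    obtain ⟨c', hc'⟩ := h _ (hF₀ i).1
    have h0 := (hF i).2
    have h0' := (hF₀ i).2
    have hc0 : c ≠ 0 := by rintro rfl; simp [hc] at h0
    have hc0' : c' ≠ 0 := by rintro rfl; simp [hc'] at h0'
    exact ⟨c / c', div_ne_zero hc0 hc0', by rw [hc', smul_smul, div_mul_cancel₀ _ hc0', hc]⟩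
  have hG₀0 : ∀ i, G₀ i ≠ 0 := by
    intro i h0
    have h1 := hFG i
    rw [h0, show genVal a 0 = 0 from MvPolynomial.eval₂_zero _ _, mul_zero, mul_eq_zero,
      map_eq_zero] at h1
    exact h1.elim (z_ne_zero _ _ _) (hF₀' i)
  have hcG : ∀ i, ∃ c : KX m n, c ≠ 0 ∧ G i = c • G₀ i := by
    intro i
    obtain ⟨f, -, -, h⟩ := exists_basis_L hm hn ha
      (w * s m n ⟨0, (Nat.zero_le m).trans_lt hn⟩) i.2.1
    obtain ⟨c, hc⟩ := h _ (hG i).1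
    obtain ⟨c', hc'⟩ := h _ (by rw [hs]; exact hG₀ i)
    have h0 := (hG i).2
    have h0' := hG₀0 i
    have hc0 : c ≠ 0 := by rintro rfl; simp [hc] at h0
    have hc0' : c' ≠ 0 := by rintro rfl; simp [hc'] at h0'
    exact ⟨c / c', div_ne_zero hc0 hc0', by rw [hc', smul_smul, div_mul_cancel₀ _ hc0', hc]⟩
  choose α hα hα' using hcF
  choose β hβ hβ' using hcG
  -- With F = αF₀ and G = βG₀, the constant α/β turns G/F into G₀/F₀.
  refine ⟨fun i => α i / β i, fun i => div_ne_zero (hα i) (hβ i), fun E _ _ x hx => ?_⟩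
  obtain ⟨-, -, t, ht, hx⟩ := hx
  have hFx := fun i => eval₂_eq_genVal ha (hF i).1 hx
  have hGx := fun i => eval₂_eq_genVal ha (hG i).1 hx
  have hne : ∀ i, (F i).eval₂ (incl m n E) x ≠ 0 := by
    intro i
    rw [hFx]
    refine mul_ne_zero (zpow_ne_zero _ ht) ?_
    simpa using genVal_ne_zero hm hn ha (hF i).1 (hF i).2
  set v : Coord m → E := fun i => algebraMap (KX m (n + 1)) E
    (fieldAct m (n + 1) hm (inclW m n w) (z m n i)) with hv
  have hv0 : v ≠ 0 := by
    intro h0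
    have h1 := congrFun h0 ⟨m, hm.le, le_rfl⟩
    simp only [hv, Pi.zero_apply, map_eq_zero] at h1
    exact z_ne_zero _ _ _ h1
  have hr' : algebraMap (KX m (n + 1)) E r ≠ 0 := by simpa using hr
  -- The degrees of G_i and F_i differ by the e₀-coordinate of w.h₀ for every `i`, so the powers of
  -- `t` contribute a common factor. The factor 1/r comes from the relation `hFG`.
  have key : ∀ i, incl m n E (α i / β i) *
      ((G i).eval₂ (incl m n E) x / (F i).eval₂ (incl m n E) x) =
      t ^ (latAct m n hn w (h m n 0)) 0 * (algebraMap (KX m (n + 1)) E r)⁻¹ * v i := by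
    intro i
    have h1 : ∀ c : KX m n, algebraMap (KX m (n + 1)) E (inclK m n c) = incl m n E c := fun _ => rfl
    have h2 := congrArg (algebraMap (KX m (n + 1)) E) (hFG i)
    have h3 : incl m n E (α i) ≠ 0 := by simpa using hα i
    have h4 : incl m n E (β i) ≠ 0 := by simpa using hβ i
    have h5 : algebraMap (KX m (n + 1)) E (genVal a (F₀ i)) ≠ 0 := by simpa using hF₀' i
    have h6 : t ^ (latAct m n hn w (e n i)) 0 ≠ 0 := zpow_ne_zero _ ht
    rw [map_mul, map_mul] at h2
    rw [hFx, hGx, hs, latRefl_zero_e hn, map_add, Pi.add_apply, zpow_add₀ ht, hα', hβ',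
      genVal_smul, genVal_smul, map_mul, map_mul, h1, h1, map_div₀]
    simp only [hv]
    field_simp
    linear_combination -h2
  have hrr : t ^ (latAct m n hn w (h m n 0)) 0 * (algebraMap (KX m (n + 1)) E r)⁻¹ ≠ 0 :=
    mul_ne_zero (zpow_ne_zero _ ht) (inv_ne_zero hr')
  refine ⟨hne, hv0, fun h0 => hv0 ?_, _, hrr, key⟩
  funext i
  have h1 := congrFun h0 i
  rw [key] at h1
  exact (mul_eq_zero.1 h1).resolve_left hrr
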